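/- **Setting.** Write $\mu^*$ for the complex conjugate, $\dagger$ for the conjugate transpose. Let $n_1,n_2\ge 1$ be integers, $N=n_1+n_2$, and let $\lambda_1\neq\lambda_2$ be complex numbers with $\lambda_i\ne\lambda_j^*$ for all $i,j\in\{1,2\}$ (so $\lambda_1,\lambda_2$ are non-real and not conjugate to each other). For $i=1,2$ let $\Phi_i(\lambda)=\Phi_i(\lambda;x,t)\in\mathbb C^2$ $(x,t\in\mathbb R)$ be an entire function of $\lambda$ with $\Phi_i(\lambda_i;x,t)\neq0$ for all $x,t$. Let $\phi_i^{[m]}=\frac1{m!}\frac{d^m}{d\lambda^m}\Phi_i\big|_{\lambda=\lambda_i}$. The two-parameter Darboux matrix is $$\mathbf T_N(\lambda;x,t)=\mathbb I+\mathbf Y\mathbf M^{-1}\mathbf D\mathbf Y^\dagger,\qquad \mathbf M=\mathbf X^\dagger\mathbf S\mathbf X,\qquad \mathbf Y=[\phi_1^{[0]},\dots,\phi_1^{[n_1-1]},\phi_2^{[0]},\dots,\phi_2^{[n_2-1]}],$$ where $\mathbf D=\mathrm{diag}(\mathbf D_1,\mathbf D_2)$, $(\mathbf D_i)_{pq}=(\lambda-\lambda_i^*)^{-(p-q+1)}$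 for $q\le p$ and $0$ for $q>p$; $\mathbf X=\mathrm{diag}(\mathbf X_1,\mathbf X_2)$, where $\mathbf X_i$ is the block upper triangular matrix with $(p,q)$ block $\phi_i^{[q-p]}$ for $p\le q$ and $0$ for $p>q$; and $\mathbf S=(\mathbf S_{ij})$, where $\mathbf S_{ij}$ has $(p,q)$ block $(-1)^p\binom{p+q}{p}(\lambda_i^*-\lambda_j)^{-(p+q+1)}\,\mathbb I_2$ (in all cases $0\le p<n_i$, and $0\le q<n_i$, respectively $0\le q<n_j$ for $\mathbf S_{ij}$). For $\mu\in\mathbb C\setminus\mathbb R$ and a function $\psi(\lambda)\in\mathbb C^2$ define recursively, for $j\ge0$, $$\Psi^{[j]}=\lim_{\epsilon\to0}\frac{\big(\mathbf T^{[j]}\cdots\mathbf T^{[1]}\psi\big)(\mu+\epsilon)}{\epsilon^j},\qquad \mathbf T^{[j+1]}(\lambda)=\mathbb I-\frac{\mu-\mu^*}{\lambda-\mu^*}\,\frac{\Psi^{[j]}(\Psi^{[j]})^\dagger}{(\Psi^{[j]})^\dagger\Psi^{[j]}}.$$ Let $\mathbf T_2^{[1]},\dots,\mathbf T_2^{[n_2]}$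 be the matrices so obtained from $(\mu,\psi)=(\lambda_2,\Phi_2)$, and $\mathbf T_1^{[1]},\dots,\mathbf T_1^{[n_1]}$ those obtained from $(\mu,\psi)=(\lambda_1,\ \mathbf T_2^{[n_2]}\cdots\mathbf T_2^{[1]}\Phi_1)$. With the roles exchanged, let $\widetilde{\mathbf T}_1^{[1]},\dots,\widetilde{\mathbf T}_1^{[n_1]}$ be obtained from $(\lambda_1,\Phi_1)$, and $\widetilde{\mathbf T}_2^{[1]},\dots,\widetilde{\mathbf T}_2^{[n_2]}$ from $(\lambda_2,\ \widetilde{\mathbf T}_1^{[n_1]}\cdots\widetilde{\mathbf T}_1^{[1]}\Phi_2)$. **Lemma 4.8.** (i) For all $x,t\in\mathbb R$: $\mathbf M$ is invertible, all the limits used in these constructions exist and are nonzero vectors, and for all $\lambda\ne\lambda_1^*,\lambda_2^*$ $$\mathbf T_N(\lambda;x,t)=\mathbf T_1^{[n_1]}\cdots\mathbf T_1^{[1]}\,\mathbf T_2^{[n_2]}\cdots\mathbf T_2^{[1]}=\widetilde{\mathbf T}_2^{[n_2]}\cdots\widetilde{\mathbf T}_2^{[1]}\,\widetilde{\mathbf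 T}_1^{[n_1]}\cdots\widetilde{\mathbf T}_1^{[1]}.$$ (ii) Now take the zero seed solution of the Hirota equation with real coefficients $\gamma,\delta$, that is $$\Phi_i(\lambda;x,t)=\begin{bmatrix}e^{2\theta^{[i]}}\\1\end{bmatrix},\qquad \theta^{[i]}=\mathrm i\lambda\big(x+(2\gamma\lambda+4\delta\lambda^2)t\big)+\sum_{j=0}^{n_i-1}a_i^{[j]}(\lambda-\lambda_i)^j-\tfrac{\mathrm i}{4}\pi,\qquad a_i^{[j]}\in\mathbb C,$$ write $\lambda_i=\lambda_{iR}+\mathrm i\lambda_{iI}$ and $v_i=-4(\lambda_{iR}\gamma-\lambda_{iI}^2\delta+3\lambda_{iR}^2\delta)$, and let $x=\xi+vt$. If $\lambda_{2I}>0$ and $v<v_2$, then $$\mathbf T_2^{[n_2]}\cdots\mathbf T_2^{[1]}=\begin{cases}\begin{bmatrix}\left(\frac{\lambda-\lambda_2}{\lambda-\lambda_2^*}\right)^{n_2}&0\\0&1\end{bmatrix}+O\big(t^{n_2-1}e^{-2\lambda_{2I}|v-v_2|t}\big),& t\to+\infty,\\[2ex] \begin{bmatrix}1&0\\0&\left(\frac{\lambda-\lambda_2}{\lambda-\lambda_2^*}\right)^{n_2}\end{bmatrix}+O\big(|t|^{n_2-1}e^{2\lambda_{2I}|v-v_2|t}\big),&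 t\to-\infty.\end{cases}$$ If $\lambda_{1I}>0$ and $v>v_1$, then $$\widetilde{\mathbf T}_1^{[n_1]}\cdots\widetilde{\mathbf T}_1^{[1]}=\begin{cases}\begin{bmatrix}1&0\\0&\left(\frac{\lambda-\lambda_1}{\lambda-\lambda_1^*}\right)^{n_1}\end{bmatrix}+O\big(t^{n_1-1}e^{-2\lambda_{1I}|v-v_1|t}\big),& t\to+\infty,\\[2ex] \begin{bmatrix}\left(\frac{\lambda-\lambda_1}{\lambda-\lambda_1^*}\right)^{n_1}&0\\0&1\end{bmatrix}+O\big(|t|^{n_1-1}e^{2\lambda_{1I}|v-v_1|t}\big),& t\to-\infty.\end{cases}$$ The $O$ terms are uniform for $\xi$ in bounded sets and for $\lambda$ outside any fixed disc around $\lambda_2^*$ (respectively $\lambda_1^*$). -/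

import Mathlib

open Filter Topology Matrix
open scoped ComplexConjugate BigOperators

noncomputable section

/-! ### The multi-parameter Darboux matrix

`lam i` are the spectral parameters, `n i` their orders, and `Φ i : ℂ → ℂ²` is the wave vector attached to
`lam i`, as a function of the spectral variable (at a fixed point `(x, t)`). -/

/-- The Taylor coefficient `(1 / m!) (d / dz)^m φ (z)` at `z = μ`. -/
def taylorVec (φ : ℂ → Fin 2 → ℂ) (μ : ℂ) (m : ℕ) : Fin 2 → ℂ :=
  ((m.factorial : ℂ)⁻¹) • iteratedDeriv m φ μ

section MultiParameter

variable {k : ℕ} (lam : Fin k → ℂ) (n : Fin k → ℕ) (Φ : Fin k → ℂ → Fin 2 → ℂ)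

/-- The `2 × N` matrix `Y_N` (with `N = ∑ i, n i`) whose columns are the Taylor coefficients of the wave vectors. -/
def darbouxY : Matrix (Fin 2) (Σ i, Fin (n i)) ℂ :=
  Matrix.of fun r c => taylorVec (Φ c.1) (lam c.1) c.2 r

/-- The block diagonal matrix `D`; its `i`-th block is lower triangular Toeplitz with entries
`1 / (z - conj (lam i)) ^ (p - q + 1)` for `q ≤ p`. -/
def darbouxD (z : ℂ) : Matrix (Σ i, Fin (n i)) (Σ i, Fin (n i)) ℂ :=
  Matrix.blockDiagonal' fun i => Matrix.of fun p q : Fin (n i) =>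
    if q ≤ p then 1 / (z - conj (lam i)) ^ ((p : ℕ) - (q : ℕ) + 1) else 0

/-- The block diagonal matrix `X`; its `i`-th block is the `2 n_i × n_i` upper triangular block Toeplitz matrix of the
Taylor coefficients of the `i`-th wave vector. -/
def darbouxX : Matrix (Σ i, Fin (n i) × Fin 2) (Σ i, Fin (n i)) ℂ :=
  Matrix.blockDiagonal' fun i => Matrix.of fun (p : Fin (n i) × Fin 2) (q : Fin (n i)) =>
    if p.1 ≤ q then taylorVec (Φ i) (lam i) ((q : ℕ) - (p.1 : ℕ)) p.2 else 0

/-- The matrix `S`; its `(i, j)` block consists of the `2 × 2` scalar matrices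
`(-1)^p * binom (p + q, p) / (conj (lam i) - lam j)^(p + q + 1) * 𝕀₂`, for `0 ≤ p < n i`, `0 ≤ q < n j`. -/
def darbouxS : Matrix (Σ i, Fin (n i) × Fin 2) (Σ i, Fin (n i) × Fin 2) ℂ :=
  Matrix.of fun a b =>
    if a.2.2 = b.2.2 then
      (-1) ^ (a.2.1 : ℕ) * (((a.2.1 : ℕ) + (b.2.1 : ℕ)).choose (a.2.1 : ℕ) : ℂ)
        / (conj (lam a.1) - lam b.1) ^ ((a.2.1 : ℕ) + (b.2.1 : ℕ) + 1)
    else 0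

/-- `M = X† S X`. -/
def darbouxM : Matrix (Σ i, Fin (n i)) (Σ i, Fin (n i)) ℂ :=
  (darbouxX lam n Φ)ᴴ * darbouxS lam n * darbouxX lam n Φ

/-- The Darboux matrix `T_N (z) = 𝕀 + Y M⁻¹ D Y†`. -/
def darbouxT (z : ℂ) : Matrix (Fin 2) (Fin 2) ℂ :=
  1 + darbouxY lam n Φ * (darbouxM lam n Φ)⁻¹ * darbouxD lam n z * (darbouxY lam n Φ)ᴴ

end MultiParameter

/-! ### Elementary Darboux matrices and their limit iteration -/

/-- The rank one matrix `φ φ† / (φ† φ)`. -/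
def rankOneProj (φ : Fin 2 → ℂ) : Matrix (Fin 2) (Fin 2) ℂ :=
  (star φ ⬝ᵥ φ)⁻¹ • Matrix.vecMulVec φ (star φ)

/-- The elementary Darboux matrix `𝕀 - (μ - conj μ) / (z - conj μ) * P`, with `P = φ φ† / (φ† φ)`. -/
def elemDarboux (μ : ℂ) (φ : Fin 2 → ℂ) (z : ℂ) : Matrix (Fin 2) (Fin 2) ℂ :=
  1 - ((μ - conj μ) / (z - conj μ)) • rankOneProj φ

/-- The quotient `(B ψ) (μ + ε) / ε ^ j`. -/
def iterQuot (μ : ℂ) (B : ℂ → Matrix (Fin 2) (Fin 2) ℂ) (ψ : ℂ → Fin 2 → ℂ) (j : ℕ) (ε : ℂ) : Fin 2 → ℂ :=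
  (ε ^ j)⁻¹ • (B (μ + ε) *ᵥ ψ (μ + ε))

/-- The product `T^[j] (z) ⋯ T^[1] (z)` of the iterated elementary Darboux matrices at the spectral point `μ`, started
from the vector function `ψ`: `T^[j+1]` is the elementary Darboux matrix at `μ` of the vector
`Φ^[j] = lim_{ε → 0} (T^[j] ⋯ T^[1] ψ) (μ + ε) / ε ^ j`. -/
def darbouxBlock (μ : ℂ) (ψ : ℂ → Fin 2 → ℂ) : ℕ → ℂ → Matrix (Fin 2) (Fin 2) ℂ
  | 0 => fun _ => 1
  | j + 1 => fun z =>
      elemDarboux μ (limUnder (𝓝[≠] (0 : ℂ)) (iterQuot μ (darbouxBlock μ ψ j) ψ j)) z * darbouxBlock μ ψ j z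

/-- The iterated vector `Φ^[j] = lim_{ε → 0} (T^[j] ⋯ T^[1] ψ) (μ + ε) / ε ^ j`. -/
def iterVec (μ : ℂ) (ψ : ℂ → Fin 2 → ℂ) (j : ℕ) : Fin 2 → ℂ :=
  limUnder (𝓝[≠] (0 : ℂ)) (iterQuot μ (darbouxBlock μ ψ j) ψ j)

theorem darbouxBlock_zero (μ : ℂ) (ψ : ℂ → Fin 2 → ℂ) (z : ℂ) : darbouxBlock μ ψ 0 z = 1 := rfl

theorem darbouxBlock_succ (μ : ℂ) (ψ : ℂ → Fin 2 → ℂ) (j : ℕ) (z : ℂ) :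
    darbouxBlock μ ψ (j + 1) z = elemDarboux μ (iterVec μ ψ j) z * darbouxBlock μ ψ j z := rfl

/-- The first `m` steps of the limit iteration are meaningful: each limit `Φ^[j]`, `j < m`, exists and is a nonzero
vector (so that the projector built from it is defined). -/
def IterationDefined (μ : ℂ) (ψ : ℂ → Fin 2 → ℂ) (m : ℕ) : Prop :=
  ∀ j < m, Tendsto (iterQuot μ (darbouxBlock μ ψ j) ψ j) (𝓝[≠] (0 : ℂ)) (𝓝 (iterVec μ ψ j)) ∧ iterVec μ ψ j ≠ 0

section TwoParameters

variable (lam : Fin 2 → ℂ) (n : Fin 2 → ℕ) (Φ : Fin 2 → ℂ → Fin 2 → ℂ)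

/-- The block `T_i^[n_i] ⋯ T_i^[1]` at `lam i` that acts first, built from the bare wave vector `Φ i`. -/
def innerBlock (i : Fin 2) : ℂ → Matrix (Fin 2) (Fin 2) ℂ :=
  darbouxBlock (lam i) (Φ i) (n i)

/-- The wave vector `Φ i` dressed by the whole block at `lam j`. -/
def dressedVec (i j : Fin 2) (z : ℂ) : Fin 2 → ℂ :=
  innerBlock lam n Φ j z *ᵥ Φ i z

/-- The block `T_i^[n_i] ⋯ T_i^[1]` at `lam i` that acts after the block at `lam j`. -/
def outerBlock (i j : Fin 2) : ℂ → Matrix (Fin 2) (Fin 2) ℂ :=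
  darbouxBlock (lam i) (dressedVec lam n Φ i j) (n i)

end TwoParameters

/-! ### Wave vectors and velocities over the zero seed solution of the Hirota equation -/

/-- The phase `θ (z) = i z (x + (2 γ z + 4 δ z²) t) + ∑_{j < m} a_j (z - μ)^j - i π / 4`. -/
def hirotaPhase (γ δ : ℝ) (μ : ℂ) {m : ℕ} (a : Fin m → ℂ) (x t : ℝ) (z : ℂ) : ℂ :=
  Complex.I * z * ((x : ℂ) + (2 * (γ : ℂ) * z + 4 * (δ : ℂ) * z ^ 2) * (t : ℂ))
    + ∑ j : Fin m, a j * (z - μ) ^ (j : ℕ) - Complex.I / 4 * (Real.pi : ℂ)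

/-- The wave vector `(exp (2 θ), 1)`. -/
def hirotaVec (γ δ : ℝ) (μ : ℂ) {m : ℕ} (a : Fin m → ℂ) (x t : ℝ) (z : ℂ) : Fin 2 → ℂ :=
  ![Complex.exp (2 * hirotaPhase γ δ μ a x t z), 1]

/-- The velocity `-4 (γ Re μ - δ (Im μ)² + 3 δ (Re μ)²)` of the soliton with spectral parameter `μ`. -/
def solitonVelocity (γ δ : ℝ) (μ : ℂ) : ℝ :=
  -4 * (μ.re * γ - μ.im ^ 2 * δ + 3 * μ.re ^ 2 * δ)

/-- `(z - μ) / (z - conj μ)`. -/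
def blaschke (μ z : ℂ) : ℂ := (z - μ) / (z - conj μ)

end

/-! Part (i) is a uniqueness argument. Call P a dressing if it is holomorphic off the points conj
λ_i, satisfies P(z) P(conj z)† = 1, has determinant the product of the Blaschke factors to the
powers n_i, maps Φ_j to a function vanishing to order n_j at λ_j, and tends to 1 at infinity
(`IsDressing`). Both iterated products are dressings. The rows of T_N have the form u = e + ∑ c_a
ρ_a, where the ρ_a are the rows of D Y†, with poles only at the conj λ_i. If u · Φ_j vanishes to
order n_j at every λ_j, then u P⁻¹ - e has only removable singularities and decays at infinity, so
Liouville gives u = e P (`IsDressing.row_eq`).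

The link with M is that its entries are, up to sign, the Taylor coefficients of ρ_a · Φ_j at λ_j
(`taylorCoef_darbouxRow_dotProduct`), so the vanishing conditions on u are the linear system c M = e
Y. For e = 0 a left null vector c of M gives ∑ c_a ρ_a = 0, hence c = 0 by comparing poles: M is
invertible. For e a basis vector, c is a row of Y M⁻¹ and u is a row of T_N. Thus T_N equals every
dressing, and the two factorizations agree.

The limits are handled by an explicit recursion for analytic vectors h_j (`reducedVec`) with (z -
conj μ)^j T^[j] ⋯ T^[1] ψ = (z - μ)^j h_j. Projecting h_{j+1}(μ) on the line of h_j(μ) returns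
h_j(μ), so no h_j(μ) vanishes.

For part (ii), rescale the wave vector so that one component is 1 and the other is exp(±2θ),
exponentially small at μ. A Cauchy estimate on the circle of radius 1/|t| bounds its m-th Taylor
coefficient by |t|^m times that exponential, so all those of index below n are O(s) with s =
|t|^(n-1) exp(...). The recursion preserves this smallness to first order in s, so every projector
is within O(s) of a coordinate projector and the product is within O(s) of a diagonal matrix
(`darbouxBlock_sub_diagonal_isBigO`). -/

/-! ### Taylor coefficients of scalar and vector functions. -/

/-- The `m`-th Taylor coefficient of a scalar function. -/
noncomputable def taylorCoef (f : ℂ → ℂ) (μ : ℂ) (m : ℕ) : ℂ :=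
  ((m.factorial : ℂ)⁻¹) * iteratedDeriv m f μ

theorem taylorVec_apply {φ : ℂ → Fin 2 → ℂ} {μ : ℂ} (h : AnalyticAt ℂ φ μ) (m : ℕ) (r : Fin 2) :
    taylorVec φ μ m r = taylorCoef (fun z => φ z r) μ m := by
  have := (ContinuousLinearMap.proj (R := ℂ) (φ := fun _ : Fin 2 => ℂ) r).iteratedFDeriv_comp_left
    (f := φ) (x := μ) (n := ⊤) (i := m) h.contDiffAt le_top
  simp only [taylorVec, taylorCoef, Pi.smul_apply, smul_eq_mul, iteratedDeriv]
  change _ = _ * (iteratedFDeriv ℂ m ((ContinuousLinearMap.proj (R := ℂ) (φ := fun _ : Fin 2 => ℂ) r) ∘ φ) μ) _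
  rw [this]
  rfl

theorem taylorCoef_mul {f g : ℂ → ℂ} {μ : ℂ} (hf : AnalyticAt ℂ f μ) (hg : AnalyticAt ℂ g μ) (m : ℕ) :
    taylorCoef (fun z => f z * g z) μ m
      = ∑ i ∈ Finset.range (m + 1), taylorCoef f μ i * taylorCoef g μ (m - i) := by
  simp only [taylorCoef]
  rw [iteratedDeriv_fun_mul hf.contDiffAt hg.contDiffAt, Finset.mul_sum]
  refine Finset.sum_congr rfl fun i hi => ?_
  have hi' : i ≤ m := Nat.lt_succ_iff.mp (Finset.mem_range.mp hi)
  rw [Nat.cast_choose ℂ hi']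
  have := Nat.cast_ne_zero (R := ℂ).mpr m.factorial_ne_zero
  field_simp

theorem taylorCoef_add {f g : ℂ → ℂ} {μ : ℂ} (hf : AnalyticAt ℂ f μ) (hg : AnalyticAt ℂ g μ) (m : ℕ) :
    taylorCoef (fun z => f z + g z) μ m = taylorCoef f μ m + taylorCoef g μ m := by
  simp only [taylorCoef]
  rw [← mul_add, ← iteratedDeriv_add hf.contDiffAt hg.contDiffAt]
  rfl

theorem taylorCoef_const_mul (c : ℂ) (f : ℂ → ℂ) (μ : ℂ) (m : ℕ) :
    taylorCoef (fun z => c * f z) μ m = c * taylorCoef f μ m := by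
  simp only [taylorCoef]
  rw [iteratedDeriv_const_mul_field]
  ring

theorem taylorCoef_sum {ι : Type*} (s : Finset ι) {f : ι → ℂ → ℂ} {μ : ℂ}
    (hf : ∀ i ∈ s, AnalyticAt ℂ (f i) μ) (m : ℕ) :
    taylorCoef (fun z => ∑ i ∈ s, f i z) μ m = ∑ i ∈ s, taylorCoef (f i) μ m := by
  simp only [taylorCoef]
  rw [iteratedDeriv_fun_sum fun i hi => (hf i hi).contDiffAt, Finset.mul_sum]

/-- The source of the signs and binomial coefficients in S: its blocks are Taylor data of the poles
in D. -/
theorem taylorCoef_inv_pow {a μ : ℂ} (m r : ℕ) :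
    taylorCoef (fun z => 1 / (z - a) ^ (m + 1)) μ r
      = (-1) ^ r * ((m + r).choose m : ℂ) / (μ - a) ^ (m + r + 1) := by
  have h1 : (fun z : ℂ => 1 / (z - a) ^ (m + 1)) = fun z => (fun w : ℂ => w ^ (-(m + 1 : ℕ) : ℤ)) (z - a) := by
    funext z
    simp only [one_div, _root_.zpow_neg, zpow_natCast]
  have h2 : (∏ i ∈ Finset.range r, (((-(m + 1 : ℕ) : ℤ) : ℂ) - i))
      = (-1) ^ r * ((m + r).factorial / m.factorial) := by
    induction r with
    | zero => simp [div_self (Nat.cast_ne_zero (R := ℂ).mpr m.factorial_ne_zero)]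
    | succ r ih =>
      rw [Finset.prod_range_succ, ih, ← add_assoc, Nat.factorial_succ]
      push_cast
      ring
  have h3 : (-(m + 1 : ℕ) : ℤ) - (r : ℤ) = -((m + r + 1 : ℕ) : ℤ) := by push_cast; ring
  rw [taylorCoef, h1, congrFun (iteratedDeriv_comp_sub_const r (fun w : ℂ => w ^ (-(m + 1 : ℕ) : ℤ)) a) μ,
    iteratedDeriv_eq_iterate, iter_deriv_zpow, h2, h3, _root_.zpow_neg, zpow_natCast, Nat.cast_add_choose]
  have := Nat.cast_ne_zero (R := ℂ).mpr m.factorial_ne_zero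
  have := Nat.cast_ne_zero (R := ℂ).mpr r.factorial_ne_zero
  field_simp

theorem isBigO_pow_of_taylorCoef_eq_zero {f : ℂ → ℂ} {μ : ℂ} {n : ℕ} (hf : AnalyticAt ℂ f μ)
    (h : ∀ m < n, taylorCoef f μ m = 0) : f =O[𝓝 μ] fun z => (z - μ) ^ n := by
  have h0 : (n : ℕ∞) ≤ analyticOrderAt f μ := by
    rw [natCast_le_analyticOrderAt_iff_iteratedDeriv_eq_zero hf]
    intro i hi
    have := h i hi
    simpa [taylorCoef, Nat.factorial_ne_zero] using this
  obtain ⟨g, hg, hfg⟩ := (natCast_le_analyticOrderAt hf).mp h0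
  have h1 : (fun z => (z - μ) ^ n • g z) =O[𝓝 μ] fun z => (z - μ) ^ n * 1 :=
    (Asymptotics.isBigO_refl _ _).mul (hg.continuousAt.tendsto.isBigO_one ℂ)
  simpa using h1.congr' (hfg.mono fun z hz => hz.symm) EventuallyEq.rfl

theorem taylorCoef_remainder_isBigO {f : ℂ → ℂ} {μ : ℂ} (hf : AnalyticAt ℂ f μ) (n : ℕ) :
    (fun z => f z - ∑ m ∈ Finset.range n, taylorCoef f μ m * (z - μ) ^ m) =O[𝓝 μ] fun z => (z - μ) ^ n := by
  have ⟨p, hp⟩ : ∃ p, HasFPowerSeriesAt f p μ := hf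
  have hc : ∀ m, p.coeff m = taylorCoef f μ m := fun m => by
    rw [hp.eq_formalMultilinearSeries hf.hasFPowerSeriesAt, taylorCoef]
    simp [FormalMultilinearSeries.coeff_ofScalars, div_eq_inv_mul]
  have h := (hp.isBigO_sub_partialSum_pow n).comp_tendsto
    (show Tendsto (fun z => z - μ) (𝓝 μ) (𝓝 0) by simpa using (continuous_sub_right μ).tendsto μ)
  refine (h.congr_left fun z => ?_).trans (Asymptotics.IsBigO.of_bound 1 (by simp))
  simp [FormalMultilinearSeries.partialSum, hc, mul_comm]

theorem HasFPowerSeriesAt.taylorVec_eq {φ : ℂ → Fin 2 → ℂ} {p : FormalMultilinearSeries ℂ ℂ (Fin 2 → ℂ)} {μ : ℂ}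
    (h : HasFPowerSeriesAt φ p μ) (m : ℕ) : taylorVec φ μ m = p.coeff m := by
  obtain ⟨r, hr⟩ := h
  have := hr.factorial_smul 1 m
  rw [taylorVec, iteratedDeriv, ← this, ← Nat.cast_smul_eq_nsmul ℂ, smul_smul, inv_mul_cancel₀ (Nat.cast_ne_zero.mpr m.factorial_ne_zero), one_smul]
  rfl

theorem taylorVec_dslope {φ : ℂ → Fin 2 → ℂ} {μ : ℂ} (h : AnalyticAt ℂ φ μ) (m : ℕ) :
    taylorVec (dslope φ μ) μ m = taylorVec φ μ (m + 1) := by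
  obtain ⟨p, hp⟩ : ∃ p, HasFPowerSeriesAt φ p μ := h
  rw [hp.taylorVec_eq, hp.has_fpower_series_dslope_fslope.taylorVec_eq, FormalMultilinearSeries.coeff_fslope]

theorem AnalyticAt.dslope {φ : ℂ → Fin 2 → ℂ} {μ : ℂ} (h : AnalyticAt ℂ φ μ) :
    AnalyticAt ℂ (dslope φ μ) μ := by
  obtain ⟨p, hp⟩ : ∃ p, HasFPowerSeriesAt φ p μ := h
  exact hp.has_fpower_series_dslope_fslope.analyticAt

theorem taylorVec_add {φ ψ : ℂ → Fin 2 → ℂ} {μ : ℂ} (hφ : AnalyticAt ℂ φ μ) (hψ : AnalyticAt ℂ ψ μ) (m : ℕ) :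
    taylorVec (fun z => φ z + ψ z) μ m = taylorVec φ μ m + taylorVec ψ μ m := by
  simp only [taylorVec]
  rw [← smul_add, ← iteratedDeriv_add hφ.contDiffAt hψ.contDiffAt]
  rfl

theorem AnalyticAt.const_mulVec {φ : ℂ → Fin 2 → ℂ} {μ : ℂ} (A : Matrix (Fin 2) (Fin 2) ℂ)
    (hφ : AnalyticAt ℂ φ μ) : AnalyticAt ℂ (fun z => A *ᵥ φ z) μ :=
  (LinearMap.toContinuousLinearMap (Matrix.mulVecLin A)).analyticAt _ |>.comp hφ

theorem taylorVec_const_mulVec {φ : ℂ → Fin 2 → ℂ} {μ : ℂ} (A : Matrix (Fin 2) (Fin 2) ℂ)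
    (hφ : AnalyticAt ℂ φ μ) (m : ℕ) : taylorVec (fun z => A *ᵥ φ z) μ m = A *ᵥ taylorVec φ μ m := by
  have h : ∀ i, AnalyticAt ℂ (fun z => φ z i) μ := analyticAt_pi_iff.mp hφ
  funext r
  rw [taylorVec_apply (hφ.const_mulVec A)]
  simp only [Matrix.mulVec, dotProduct, taylorVec_apply hφ]
  rw [taylorCoef_sum (f := fun i z => A r i * φ z i) _ fun i _ => analyticAt_const.mul (h i)]
  exact Finset.sum_congr rfl fun i _ => taylorCoef_const_mul _ _ _ _

theorem taylorVec_zero (φ : ℂ → Fin 2 → ℂ) (μ : ℂ) : taylorVec φ μ 0 = φ μ := by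
  simp [taylorVec]

/-! ### Rank one projectors and elementary Darboux matrices. -/

open scoped ComplexOrder in
theorem star_dotProduct_self_ne_zero {φ : Fin 2 → ℂ} (h : φ ≠ 0) : star φ ⬝ᵥ φ ≠ 0 := fun h' =>
  h (dotProduct_star_self_eq_zero.mp h')

theorem rankOneProj_smul {c : ℂ} (hc : c ≠ 0) (φ : Fin 2 → ℂ) : rankOneProj (c • φ) = rankOneProj φ := by
  have hc' : star c ≠ 0 := star_ne_zero.mpr hc
  rw [rankOneProj, rankOneProj, star_smul, smul_dotProduct, dotProduct_smul, smul_vecMulVec, vecMulVec_smul,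
    smul_smul, smul_smul]
  congr 1
  simp only [smul_eq_mul, mul_inv]
  field_simp

theorem rankOneProj_mulVec_self (φ : Fin 2 → ℂ) : rankOneProj φ *ᵥ φ = φ := by
  by_cases h : φ = 0
  · simp [h]
  · rw [rankOneProj, smul_mulVec, vecMulVec_mulVec]
    ext i
    rw [Pi.smul_apply, Pi.smul_apply, MulOpposite.smul_eq_mul_unop, MulOpposite.unop_op, smul_eq_mul, mul_comm,
      mul_assoc, mul_inv_cancel₀ (star_dotProduct_self_ne_zero h), mul_one]

theorem rankOneProj_mul_self (φ : Fin 2 → ℂ) : rankOneProj φ * rankOneProj φ = rankOneProj φ := by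
  have h : rankOneProj φ * vecMulVec φ (star φ) = vecMulVec φ (star φ) := by
    rw [mul_vecMulVec, rankOneProj_mulVec_self]
  conv_lhs => enter [2]; rw [rankOneProj]
  rw [Matrix.mul_smul, h, rankOneProj]

theorem conjTranspose_rankOneProj (φ : Fin 2 → ℂ) : (rankOneProj φ)ᴴ = rankOneProj φ := by
  rw [rankOneProj, conjTranspose_smul, conjTranspose_vecMulVec, star_star, star_inv₀]
  congr 2
  simp [dotProduct, mul_comm]

theorem elemDarboux_smul {c : ℂ} (hc : c ≠ 0) (μ : ℂ) (φ : Fin 2 → ℂ) : elemDarboux μ (c • φ) = elemDarboux μ φ := by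
  funext z
  rw [elemDarboux, rankOneProj_smul hc, elemDarboux]

theorem elemDarboux_apply (μ : ℂ) (φ : Fin 2 → ℂ) (z : ℂ) (r s : Fin 2) :
    elemDarboux μ φ z r s = (1 : Matrix (Fin 2) (Fin 2) ℂ) r s - (μ - conj μ) / (z - conj μ) * rankOneProj φ r s := rfl

theorem elemDarboux_mul_conjTranspose {μ z : ℂ} (φ : Fin 2 → ℂ) (h : z ≠ μ) (h' : z ≠ conj μ) :
    elemDarboux μ φ z * (elemDarboux μ φ (conj z))ᴴ = 1 := by
  have h1 := sub_ne_zero.mpr h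
  have h2 := sub_ne_zero.mpr h'
  have h3 : star ((μ - conj μ) / (conj z - conj μ)) = (conj μ - μ) / (z - μ) := by
    simp
  rw [elemDarboux, elemDarboux, conjTranspose_sub, conjTranspose_smul, conjTranspose_rankOneProj, conjTranspose_one,
    h3, sub_mul, mul_sub, mul_sub, one_mul, one_mul, mul_one, smul_mul_smul_comm, rankOneProj_mul_self]
  rw [sub_sub, sub_eq_self, ← add_sub_assoc, ← add_smul, ← sub_smul]
  convert! zero_smul ℂ _
  field_simp
  ring

theorem det_elemDarboux {μ z : ℂ} {φ : Fin 2 → ℂ} (hφ : φ ≠ 0) (h : z ≠ conj μ) :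
    (elemDarboux μ φ z).det = blaschke μ z := by
  have h2 := sub_ne_zero.mpr h
  have h' := star_dotProduct_self_ne_zero hφ
  have e : star φ ⬝ᵥ φ = star (φ 0) * φ 0 + star (φ 1) * φ 1 := by simp [dotProduct, Fin.sum_univ_two]
  rw [det_fin_two]
  simp only [elemDarboux_apply, rankOneProj, Matrix.smul_apply, vecMulVec_apply, smul_eq_mul, blaschke]
  generalize star φ ⬝ᵥ φ = s at *
  simp
  have e' : conj (φ 0) * φ 0 = s - conj (φ 1) * φ 1 := by rw [e]; simp
  field_simp
  linear_combination (μ - conj μ) * s * (conj μ - z) * e'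

theorem differentiableAt_elemDarboux (μ : ℂ) (φ : Fin 2 → ℂ) {z : ℂ} (h : z ≠ conj μ) (r s : Fin 2) :
    DifferentiableAt ℂ (fun z => elemDarboux μ φ z r s) z := by
  simp only [elemDarboux_apply]
  have := sub_ne_zero.mpr h
  fun_prop (disch := assumption)

theorem tendsto_div_sub_cocompact (a b : ℂ) : Tendsto (fun z => a / (z - b)) (cocompact ℂ) (𝓝 0) := by
  have h : Tendsto (fun z : ℂ => z - b) (cocompact ℂ) (cocompact ℂ) := by
    simpa [sub_eq_add_neg] using (Homeomorph.addRight (-b)).isClosedEmbedding.tendsto_cocompact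
  simpa [div_eq_mul_inv] using ((tendsto_inv₀_cobounded (α := ℂ)).comp
    (Metric.cobounded_eq_cocompact (α := ℂ) ▸ h)).const_mul a

theorem tendsto_elemDarboux_cocompact (μ : ℂ) (φ : Fin 2 → ℂ) (r s : Fin 2) :
    Tendsto (fun z => elemDarboux μ φ z r s) (cocompact ℂ) (𝓝 ((1 : Matrix (Fin 2) (Fin 2) ℂ) r s)) := by
  simp only [elemDarboux_apply]
  simpa using ((tendsto_div_sub_cocompact (μ - conj μ) (conj μ)).mul_const (rankOneProj φ r s)).const_sub _

/-! ### Analytic properties of the iterated blocks. -/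

theorem darbouxBlock_mul_conjTranspose {μ z : ℂ} (ψ : ℂ → Fin 2 → ℂ) (h : z ≠ μ) (h' : z ≠ conj μ) (m : ℕ) :
    darbouxBlock μ ψ m z * (darbouxBlock μ ψ m (conj z))ᴴ = 1 := by
  induction m with
  | zero => simp [darbouxBlock_zero]
  | succ m ih =>
    rw [darbouxBlock_succ, darbouxBlock_succ, conjTranspose_mul, Matrix.mul_assoc, ← Matrix.mul_assoc _ _ (_ᴴ), ih,
      Matrix.one_mul, elemDarboux_mul_conjTranspose _ h h']

theorem det_darbouxBlock {μ z : ℂ} {ψ : ℂ → Fin 2 → ℂ} {m : ℕ} (hψ : ∀ j < m, iterVec μ ψ j ≠ 0) (h : z ≠ conj μ) :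
    (darbouxBlock μ ψ m z).det = blaschke μ z ^ m := by
  induction m with
  | zero => simp [darbouxBlock_zero]
  | succ m ih =>
    rw [darbouxBlock_succ, det_mul, det_elemDarboux (hψ m m.lt_succ_self) h,
      ih fun j hj => hψ j (hj.trans m.lt_succ_self), pow_succ']

theorem differentiableAt_mul_apply {A B : ℂ → Matrix (Fin 2) (Fin 2) ℂ} {z : ℂ}
    (hA : ∀ r s, DifferentiableAt ℂ (fun z => A z r s) z) (hB : ∀ r s, DifferentiableAt ℂ (fun z => B z r s) z)
    (r s : Fin 2) : DifferentiableAt ℂ (fun z => (A z * B z) r s) z := by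
  simp only [Matrix.mul_apply, Fin.sum_univ_two]
  exact ((hA r 0).mul (hB 0 s)).add ((hA r 1).mul (hB 1 s))

theorem tendsto_mul_apply {l : Filter ℂ} {A B : ℂ → Matrix (Fin 2) (Fin 2) ℂ} {a b : Matrix (Fin 2) (Fin 2) ℂ}
    (hA : ∀ r s, Tendsto (fun z => A z r s) l (𝓝 (a r s))) (hB : ∀ r s, Tendsto (fun z => B z r s) l (𝓝 (b r s)))
    (r s : Fin 2) : Tendsto (fun z => (A z * B z) r s) l (𝓝 ((a * b) r s)) := by
  simp only [Matrix.mul_apply, Fin.sum_univ_two]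
  exact ((hA r 0).mul (hB 0 s)).add ((hA r 1).mul (hB 1 s))

theorem differentiableAt_darbouxBlock (μ : ℂ) (ψ : ℂ → Fin 2 → ℂ) (m : ℕ) {z : ℂ} (h : z ≠ conj μ) (r s : Fin 2) :
    DifferentiableAt ℂ (fun z => darbouxBlock μ ψ m z r s) z := by
  induction m generalizing r s with
  | zero => simp [darbouxBlock_zero]
  | succ m ih => exact differentiableAt_mul_apply (differentiableAt_elemDarboux μ _ h) ih r s

theorem tendsto_darbouxBlock_cocompact (μ : ℂ) (ψ : ℂ → Fin 2 → ℂ) (m : ℕ) (r s : Fin 2) :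
    Tendsto (fun z => darbouxBlock μ ψ m z r s) (cocompact ℂ) (𝓝 ((1 : Matrix (Fin 2) (Fin 2) ℂ) r s)) := by
  induction m generalizing r s with
  | zero => simp [darbouxBlock_zero]
  | succ m ih => simpa [darbouxBlock_succ] using tendsto_mul_apply (tendsto_elemDarboux_cocompact μ (iterVec μ ψ m)) ih r s

/-! ### The limit iteration as an analytic recursion. -/

/-- The function `h_j` with `(z - conj μ)^j T^[j] ⋯ T^[1] ψ = (z - μ)^j h_j`. -/
noncomputable def reducedVec (μ : ℂ) (ψ : ℂ → Fin 2 → ℂ) : ℕ → ℂ → Fin 2 → ℂ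
  | 0 => ψ
  | j + 1 => fun z => reducedVec μ ψ j z
      + ((μ - conj μ) • (1 - rankOneProj (reducedVec μ ψ j μ))) *ᵥ dslope (reducedVec μ ψ j) μ z

section Iteration

variable {μ : ℂ} {ψ : ℂ → Fin 2 → ℂ}

theorem analyticAt_reducedVec (hψ : AnalyticAt ℂ ψ μ) (j : ℕ) : AnalyticAt ℂ (reducedVec μ ψ j) μ := by
  induction j with
  | zero => exact hψ
  | succ j ih => exact ih.add (ih.dslope.const_mulVec _)

/-- The correction added in the recursion lies in the range of 1 - P, which P kills. Hence a zero of
the next vector at μ would force a zero of the current one. -/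
theorem rankOneProj_mulVec_reducedVec_succ (j : ℕ) :
    rankOneProj (reducedVec μ ψ j μ) *ᵥ reducedVec μ ψ (j + 1) μ = reducedVec μ ψ j μ := by
  rw [reducedVec, mulVec_add, rankOneProj_mulVec_self, mulVec_mulVec, Matrix.mul_smul, mul_sub, mul_one, rankOneProj_mul_self]
  simp

theorem reducedVec_ne_zero (h0 : ψ μ ≠ 0) (j : ℕ) : reducedVec μ ψ j μ ≠ 0 := by
  induction j with
  | zero => exact h0
  | succ j ih =>
    intro h
    apply ih
    rw [← rankOneProj_mulVec_reducedVec_succ, h, mulVec_zero]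

/-- With P the projector on h_j(μ), (z - conj μ) - (μ - conj μ) P = (z - μ) + (μ - conj μ)(1 - P).
Since 1 - P kills h_j(μ), it lets h_j(z) be replaced by h_j(z) - h_j(μ), which is z - μ times the
divided difference. -/
theorem elemDarboux_mulVec_reducedVec (j : ℕ) {z : ℂ} (hz : z ≠ conj μ) :
    (z - conj μ) • (elemDarboux μ (reducedVec μ ψ j μ) z *ᵥ reducedVec μ ψ j z)
      = (z - μ) • reducedVec μ ψ (j + 1) z := by
  have h1 := sub_ne_zero.mpr hz
  have h2 : (z - μ) • dslope (reducedVec μ ψ j) μ z = reducedVec μ ψ j z - reducedVec μ ψ j μ :=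
    sub_smul_dslope _ _ _
  rw [reducedVec, smul_add, ← mulVec_smul _ (z - μ), h2, elemDarboux, sub_mulVec, one_mulVec, smul_sub, smul_mulVec, smul_mulVec,
    smul_smul, sub_mulVec, one_mulVec, mulVec_sub, rankOneProj_mulVec_self, mul_div_cancel₀ _ h1]
  module

/-- The two statements are interlocked: the factorization at j gives the limit at j, and that limit
identifies the next elementary matrix, needed for the factorization at j + 1. -/
theorem iterVec_and_block (hμ : μ ≠ conj μ) (hψ : AnalyticAt ℂ ψ μ) (j : ℕ) :
    (∀ z, z ≠ conj μ → (z - conj μ) ^ j • (darbouxBlock μ ψ j z *ᵥ ψ z) = (z - μ) ^ j • reducedVec μ ψ j z) ∧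
    Tendsto (iterQuot μ (darbouxBlock μ ψ j) ψ j) (𝓝[≠] (0 : ℂ))
      (𝓝 (((μ - conj μ) ^ j)⁻¹ • reducedVec μ ψ j μ)) := by
  have hd : μ - conj μ ≠ 0 := sub_ne_zero.mpr hμ
  have step : ∀ j, (∀ z, z ≠ conj μ →
        (z - conj μ) ^ j • (darbouxBlock μ ψ j z *ᵥ ψ z) = (z - μ) ^ j • reducedVec μ ψ j z) →
      Tendsto (iterQuot μ (darbouxBlock μ ψ j) ψ j) (𝓝[≠] (0 : ℂ))
        (𝓝 (((μ - conj μ) ^ j)⁻¹ • reducedVec μ ψ j μ)) := by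
    intro j hj
    -- For small ε ≠ 0 the factorization cancels ε^j and turns the quotient into this function,
    -- continuous at 0.
    have hc : ContinuousAt (fun ε : ℂ => ((μ + ε - conj μ) ^ j)⁻¹ • reducedVec μ ψ j (μ + ε)) 0 := by
      refine ContinuousAt.smul (ContinuousAt.inv₀ (f := fun ε : ℂ => (μ + ε - conj μ) ^ j) (by fun_prop)
        (by simpa using fun h => absurd h hd)) ?_
      exact ContinuousAt.comp (by simpa using (analyticAt_reducedVec hψ j).continuousAt) (by fun_prop)
    have ht := hc.tendsto.mono_left (nhdsWithin_le_nhds (s := {0}ᶜ))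
    simp only [add_zero] at ht
    have hev : ∀ᶠ ε : ℂ in 𝓝 0, μ + ε - conj μ ≠ 0 :=
      ContinuousAt.eventually_ne (by fun_prop) (by simpa using hd)
    refine ht.congr' ?_
    filter_upwards [self_mem_nhdsWithin, nhdsWithin_le_nhds hev] with ε hε hε'
    have := hj (μ + ε) (sub_ne_zero.mp hε')
    rw [add_sub_cancel_left] at this
    rw [iterQuot, ← inv_smul_smul₀ (pow_ne_zero j hε') (darbouxBlock μ ψ j (μ + ε) *ᵥ ψ (μ + ε)), this,
      smul_comm, inv_smul_smul₀ (pow_ne_zero j hε)]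
  suffices h : ∀ z, z ≠ conj μ →
      (z - conj μ) ^ j • (darbouxBlock μ ψ j z *ᵥ ψ z) = (z - μ) ^ j • reducedVec μ ψ j z from ⟨h, step j h⟩
  induction j with
  | zero => simp [darbouxBlock_zero, reducedVec]
  | succ j ih =>
    intro z hz
    have hv : iterVec μ ψ j = ((μ - conj μ) ^ j)⁻¹ • reducedVec μ ψ j μ := (step j ih).limUnder_eq
    rw [darbouxBlock_succ, hv, elemDarboux_smul (inv_ne_zero (pow_ne_zero j hd)), pow_succ', pow_succ', ← smul_smul,
      ← mulVec_mulVec, ← mulVec_smul, ih z hz, mulVec_smul, smul_comm, elemDarboux_mulVec_reducedVec j hz, smul_smul,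
      mul_comm]

theorem iterVec_eq (hμ : μ ≠ conj μ) (hψ : AnalyticAt ℂ ψ μ) (j : ℕ) :
    iterVec μ ψ j = ((μ - conj μ) ^ j)⁻¹ • reducedVec μ ψ j μ :=
  (iterVec_and_block hμ hψ j).2.limUnder_eq

theorem iterationDefined (hμ : μ ≠ conj μ) (hψ : AnalyticAt ℂ ψ μ) (h0 : ψ μ ≠ 0) (m : ℕ) :
    IterationDefined μ ψ m := by
  intro j _
  rw [iterVec_eq hμ hψ j]
  exact ⟨(iterVec_and_block hμ hψ j).2, smul_ne_zero (inv_ne_zero (pow_ne_zero j (sub_ne_zero.mpr hμ)))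
    (reducedVec_ne_zero h0 j)⟩

theorem darbouxBlock_mulVec_isBigO (hμ : μ ≠ conj μ) (hψ : AnalyticAt ℂ ψ μ) (m : ℕ) (r : Fin 2) :
    (fun z => (darbouxBlock μ ψ m z *ᵥ ψ z) r) =O[𝓝 μ] fun z => (z - μ) ^ m := by
  have hd : μ - conj μ ≠ 0 := sub_ne_zero.mpr hμ
  have hev : ∀ᶠ z : ℂ in 𝓝 μ, z - conj μ ≠ 0 := ContinuousAt.eventually_ne (by fun_prop) hd
  have hc : ContinuousAt (fun z : ℂ => ((z - conj μ) ^ m)⁻¹ * reducedVec μ ψ m z r) μ := by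
    refine ContinuousAt.mul (ContinuousAt.inv₀ (by fun_prop) (pow_ne_zero m hd)) ?_
    exact (continuous_apply r).continuousAt.comp (analyticAt_reducedVec hψ m).continuousAt
  have h := (Asymptotics.isBigO_refl (fun z => (z - μ) ^ m) (𝓝 μ)).mul (hc.tendsto.isBigO_one ℂ)
  simp only [mul_one] at h
  refine h.congr' ?_ EventuallyEq.rfl
  filter_upwards [hev] with z hz
  have := congrFun ((iterVec_and_block hμ hψ m).1 z (sub_ne_zero.mp hz)) r
  simp only [Pi.smul_apply, smul_eq_mul] at this
  rw [mul_left_comm, ← this, inv_mul_cancel_left₀ (pow_ne_zero m hz)]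

end Iteration

/-! ### Liouville's theorem with removable singularities. -/

/-- Liouville's theorem for functions with finitely many removable singularities. -/
theorem eq_zero_of_removable_of_tendsto_cocompact (S : Finset ℂ) {F : ℂ → ℂ}
    (hd : ∀ z ∉ S, DifferentiableAt ℂ F z) (hb : ∀ s ∈ S, F =O[𝓝[≠] s] fun _ => (1 : ℂ))
    (ht : Tendsto F (cocompact ℂ) (𝓝 0)) : ∀ z ∉ S, F z = 0 := by
  induction S using Finset.induction_on generalizing F with
  | empty => exact fun z _ => Differentiable.apply_eq_of_tendsto_cocompact (fun z => hd z (by simp)) z ht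
  | insert s S hs ih =>
    -- Filling in the value at s removes one point from the exceptional set, so the induction
    -- hypothesis applies to G.
    set G := Function.update F s (limUnder (𝓝[≠] s) F) with hG
    have hne : ∀ z, z ≠ s → G =ᶠ[𝓝 z] F := fun z hz => by
      filter_upwards [isOpen_ne.mem_nhds hz] with w hw
      exact Function.update_of_ne hw _ _
    have key : ∀ z ∉ S, G z = 0 := by
      refine ih (fun z hz => ?_) (fun t ht => ?_) ?_
      · by_cases hzs : z = s
        · subst hzs
          have hU : {w | DifferentiableAt ℂ F w} ∈ 𝓝[≠] z := by
            have : ((insert z S : Finset ℂ) : Set ℂ)ᶜ ∪ {z} ∈ 𝓝 z := by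
              have h1 : (S : Set ℂ)ᶜ ∈ 𝓝 z := S.finite_toSet.isClosed.isOpen_compl.mem_nhds hz
              filter_upwards [h1] with w hw
              by_cases hwz : w = z
              · exact Or.inr hwz
              · left
                simpa [hwz] using hw
            filter_upwards [nhdsWithin_le_nhds this, self_mem_nhdsWithin] with w hw hw'
            exact hd w (by simpa using hw.resolve_right hw')
          -- Boundedness is stronger than o(1/(w - z)), the hypothesis of the removable singularity
          -- theorem.
          have ho : (fun w => F w - F z) =o[𝓝[≠] z] fun w => (w - z)⁻¹ := by
            have h1 := (hb z (Finset.mem_insert_self _ _)).sub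
              (Asymptotics.isBigO_const_const (F z) (one_ne_zero (α := ℂ)) (𝓝[≠] z))
            refine h1.trans_isLittleO ?_
            rw [Asymptotics.isLittleO_one_left_iff]
            have : Tendsto (fun w => w - z) (𝓝[≠] z) (𝓝[≠] 0) := by
              refine tendsto_nhdsWithin_iff.mpr ⟨?_, ?_⟩
              · exact Tendsto.mono_left (by simpa using (continuous_sub_right z).tendsto z) nhdsWithin_le_nhds
              · filter_upwards [self_mem_nhdsWithin] with w hw using sub_ne_zero.mpr hw
            exact tendsto_norm_cobounded_atTop.comp (tendsto_inv₀_nhdsNE_zero.comp this)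
          exact (Complex.differentiableOn_update_limUnder_insert_of_isLittleO hU
            (fun w hw => DifferentiableAt.differentiableWithinAt hw) ho).differentiableAt (insert_mem_nhds_iff.mpr hU)
        · exact (hd z (by simp [hzs, hz])).congr_of_eventuallyEq (hne z hzs)
      · have hts : t ≠ s := fun h => hs (h ▸ ht)
        exact (hb t (Finset.mem_insert_of_mem ht)).congr' (nhdsWithin_le_nhds (hne t hts).symm) EventuallyEq.rfl
      · refine ht.congr' ?_
        filter_upwards [(isCompact_singleton (x := s)).compl_mem_cocompact] with w hw
        exact (Function.update_of_ne hw _ _).symm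
    intro z hz
    rw [Finset.mem_insert, not_or] at hz
    rw [← key z hz.2, hG, Function.update_of_ne hz.1]

theorem Fin.sum_ite_le_eq_sum_range {n : ℕ} (p : Fin n) (F : ℕ → ℂ) :
    (∑ x : Fin n, if x ≤ p then F x else 0) = ∑ a ∈ Finset.range (p + 1), F a := by
  rw [← Finset.sum_filter, Finset.sum_range]
  refine Finset.sum_bij' (fun (x : Fin n) hx => (⟨x, Nat.lt_succ_of_le (Fin.le_def.mp (Finset.mem_filter.mp hx).2)⟩ : Fin (p + 1)))
    (fun (y : Fin (p + 1)) _ => (⟨y, lt_of_le_of_lt (Nat.lt_succ_iff.mp y.2) p.2⟩ : Fin n)) ?_ ?_ ?_ ?_ ?_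
  · intro x _
    exact Finset.mem_univ _
  · intro y _
    exact Finset.mem_filter.mpr ⟨Finset.mem_univ _, Fin.le_def.mpr (Nat.lt_succ_iff.mp y.2)⟩
  · intro x _
    rfl
  · intro y _
    rfl
  · intro x _
    rfl

/-! ### The rows of D Y† and the entries of M. -/

section Rows

variable {k : ℕ} (lam : Fin k → ℂ) (n : Fin k → ℕ) (Φ : Fin k → ℂ → Fin 2 → ℂ)

/-- The rows of `D Y†`. -/
noncomputable def darbouxRow (a : Σ i, Fin (n i)) (z : ℂ) : Fin 2 → ℂ :=
  fun s => (darbouxD lam n z * (darbouxY lam n Φ)ᴴ) a s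

theorem darbouxRow_apply (i : Fin k) (p : Fin (n i)) (z : ℂ) (s : Fin 2) :
    darbouxRow lam n Φ ⟨i, p⟩ z s = ∑ q ∈ Finset.range (p + 1),
      1 / (z - conj (lam i)) ^ ((p : ℕ) - q + 1) * conj (taylorVec (Φ i) (lam i) q s) := by
  rw [← Fin.sum_ite_le_eq_sum_range p fun q =>
      1 / (z - conj (lam i)) ^ ((p : ℕ) - q + 1) * conj (taylorVec (Φ i) (lam i) q s),
    darbouxRow, Matrix.mul_apply, Fintype.sum_sigma, Finset.sum_eq_single i]
  · refine Finset.sum_congr rfl fun q _ => ?_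
    rw [darbouxD, blockDiagonal'_apply_eq, conjTranspose_apply, darbouxY, of_apply, of_apply]
    simp
  · intro j _ hj
    refine Finset.sum_eq_zero fun q _ => ?_
    rw [darbouxD, blockDiagonal'_apply_ne _ _ _ hj.symm, zero_mul]
  · simp

theorem darbouxM_apply (i j : Fin k) (p : Fin (n i)) (q : Fin (n j)) :
    darbouxM lam n Φ ⟨i, p⟩ ⟨j, q⟩ = ∑ a ∈ Finset.range (p + 1), ∑ b ∈ Finset.range (q + 1), ∑ s : Fin 2,
      conj (taylorVec (Φ i) (lam i) (p - a) s) *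
        ((-1) ^ a * ((a + b).choose a : ℂ) / (conj (lam i) - lam j) ^ (a + b + 1)) *
          taylorVec (Φ j) (lam j) (q - b) s := by
  rw [darbouxM, Matrix.mul_assoc, Matrix.mul_apply, Fintype.sum_sigma, Finset.sum_eq_single i]
  rotate_left
  · intro i' _ hi'
    refine Finset.sum_eq_zero fun x _ => ?_
    rw [conjTranspose_apply, darbouxX, blockDiagonal'_apply_ne _ _ _ hi', star_zero, zero_mul]
  · simp
  rw [Fintype.sum_prod_type, ← Fin.sum_ite_le_eq_sum_range p fun a => ∑ b ∈ Finset.range (q + 1), ∑ s : Fin 2,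
      conj (taylorVec (Φ i) (lam i) (p - a) s) *
        ((-1) ^ a * ((a + b).choose a : ℂ) / (conj (lam i) - lam j) ^ (a + b + 1)) *
          taylorVec (Φ j) (lam j) (q - b) s]
  refine Finset.sum_congr rfl fun a _ => ?_
  have hS : ∀ s : Fin 2, (darbouxS lam n * darbouxX lam n Φ) ⟨i, a, s⟩ ⟨j, q⟩ = ∑ b ∈ Finset.range (q + 1),
      ((-1) ^ (a : ℕ) * (((a : ℕ) + b).choose a : ℂ) / (conj (lam i) - lam j) ^ ((a : ℕ) + b + 1)) *
          taylorVec (Φ j) (lam j) (q - b) s := by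
    intro s
    rw [Matrix.mul_apply, Fintype.sum_sigma, Finset.sum_eq_single j]
    rotate_left
    · intro j' _ hj'
      refine Finset.sum_eq_zero fun x _ => ?_
      rw [darbouxX, blockDiagonal'_apply_ne _ _ _ hj', mul_zero]
    · simp
    rw [Fintype.sum_prod_type, ← Fin.sum_ite_le_eq_sum_range q fun b =>
      ((-1) ^ (a : ℕ) * (((a : ℕ) + b).choose a : ℂ) / (conj (lam i) - lam j) ^ ((a : ℕ) + b + 1)) *
          taylorVec (Φ j) (lam j) (q - b) s]
    refine Finset.sum_congr rfl fun b _ => ?_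
    rw [Finset.sum_eq_single s]
    · rw [darbouxX, blockDiagonal'_apply_eq, darbouxS, of_apply, of_apply]
      simp
    · intro s' _ hs'
      rw [darbouxS, of_apply, if_neg (by exact hs'.symm), zero_mul]
    · simp
  simp only [hS]
  by_cases hap : a ≤ p
  · rw [if_pos hap, Finset.sum_comm]
    refine Finset.sum_congr rfl fun s _ => ?_
    rw [conjTranspose_apply, darbouxX, blockDiagonal'_apply_eq, of_apply, if_pos hap, Finset.mul_sum]
    refine Finset.sum_congr rfl fun b _ => ?_
    simp [mul_assoc]
  · rw [if_neg hap]
    refine Finset.sum_eq_zero fun s _ => ?_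
    rw [conjTranspose_apply, darbouxX, blockDiagonal'_apply_eq, of_apply, if_neg hap, star_zero, zero_mul]

variable {lam n Φ}

theorem differentiableAt_darbouxRow {i : Fin k} (p : Fin (n i)) {z : ℂ} (hz : z ≠ conj (lam i)) (s : Fin 2) :
    DifferentiableAt ℂ (fun z => darbouxRow lam n Φ ⟨i, p⟩ z s) z := by
  have h := sub_ne_zero.mpr hz
  simp only [darbouxRow_apply]
  refine DifferentiableAt.fun_sum fun q _ => ?_
  have := pow_ne_zero ((p : ℕ) - q + 1) h
  fun_prop (disch := assumption)

theorem tendsto_darbouxRow_cocompact (a : Σ i, Fin (n i)) (s : Fin 2) :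
    Tendsto (fun z => darbouxRow lam n Φ a z s) (cocompact ℂ) (𝓝 0) := by
  obtain ⟨i, p⟩ := a
  simp only [darbouxRow_apply]
  rw [← Finset.sum_const_zero (s := Finset.range (p + 1))]
  refine tendsto_finsetSum _ fun q _ => ?_
  have h := (tendsto_div_sub_cocompact 1 (conj (lam i))).pow ((p : ℕ) - q + 1)
  simpa using h.mul_const _

/-- Leibniz' rule applied to (z - conj λ_i)^(-(a+1)) times Φ_j reproduces the sum defining X† S X.
This turns vanishing conditions at the λ_j into linear equations with matrix M. -/
theorem taylorCoef_darbouxRow_dotProduct (hΦ : ∀ j, AnalyticAt ℂ (Φ j) (lam j)) (hconj : ∀ i j, lam i ≠ conj (lam j))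
    (i j : Fin k) (p : Fin (n i)) (q : Fin (n j)) :
    taylorCoef (fun z => darbouxRow lam n Φ ⟨i, p⟩ z ⬝ᵥ Φ j z) (lam j) q = -darbouxM lam n Φ ⟨i, p⟩ ⟨j, q⟩ := by
  have hne := sub_ne_zero.mpr (hconj j i)
  have hA : ∀ m : ℕ, AnalyticAt ℂ (fun z => 1 / (z - conj (lam i)) ^ (m + 1)) (lam j) := fun m => by
    have := pow_ne_zero (m + 1) hne
    fun_prop (disch := assumption)
  have hΦs : ∀ s, AnalyticAt ℂ (fun z => Φ j z s) (lam j) := analyticAt_pi_iff.mp (hΦ j)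
  have h1 : (fun z => darbouxRow lam n Φ ⟨i, p⟩ z ⬝ᵥ Φ j z) = fun z => ∑ a ∈ Finset.range (p + 1), ∑ s : Fin 2,
      conj (taylorVec (Φ i) (lam i) (p - a) s) * (1 / (z - conj (lam i)) ^ (a + 1) * Φ j z s) := by
    funext z
    simp only [dotProduct, darbouxRow_apply]
    rw [Finset.sum_comm]
    refine Finset.sum_congr rfl fun s _ => ?_
    -- Reindexing by a = p - q makes the pole order a + 1, matching the row index of S.
    rw [← Finset.sum_range_reflect, Finset.sum_mul]
    refine Finset.sum_congr rfl fun a ha => ?_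
    have ha' : a ≤ p := Nat.lt_succ_iff.mp (Finset.mem_range.mp ha)
    rw [show (p : ℕ) + 1 - 1 - a = p - a by omega, show (p : ℕ) - (p - a) = a by omega]
    ring
  have hT : ∀ (a : ℕ) (s : Fin 2), AnalyticAt ℂ (fun z => conj (taylorVec (Φ i) (lam i) (p - a) s) *
      (1 / (z - conj (lam i)) ^ (a + 1) * Φ j z s)) (lam j) := fun a s =>
    analyticAt_const.mul ((hA a).mul (hΦs s))
  rw [h1, taylorCoef_sum (f := fun a z => ∑ s : Fin 2, conj (taylorVec (Φ i) (lam i) (p - a) s) *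
      (1 / (z - conj (lam i)) ^ (a + 1) * Φ j z s)) _ fun a _ => Finset.analyticAt_fun_sum _ fun s _ => hT a s,
    darbouxM_apply, ← Finset.sum_neg_distrib]
  refine Finset.sum_congr rfl fun a _ => ?_
  rw [taylorCoef_sum _ fun s _ => hT a s, Finset.sum_comm (s := Finset.range _),
    ← Finset.sum_neg_distrib]
  refine Finset.sum_congr rfl fun s _ => ?_
  rw [taylorCoef_const_mul, taylorCoef_mul (hA a) (hΦs s), Finset.mul_sum, ← Finset.sum_neg_distrib]
  refine Finset.sum_congr rfl fun b _ => ?_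
  rw [taylorCoef_inv_pow, ← taylorVec_apply (hΦ j)]
  have h2 : (lam j - conj (lam i)) ^ (a + b + 1) = (-1) ^ (a + b + 1) * (conj (lam i) - lam j) ^ (a + b + 1) := by
    rw [← mul_pow]; ring
  -- Reversing the difference costs (-1)^(a+b+1), which trades (-1)^b for -(-1)^a; this is the
  -- overall minus sign.
  have h3 : (-1 : ℂ) ^ b / (lam j - conj (lam i)) ^ (a + b + 1)
      = -((-1) ^ a / (conj (lam i) - lam j) ^ (a + b + 1)) := by
    rw [h2, ← neg_sub (lam j), pow_succ, pow_add]
    have ea : (-1 : ℂ) ^ a * (-1) ^ a = 1 := by rw [← mul_pow]; simp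
    have eb : (-1 : ℂ) ^ b ≠ 0 := by simp
    have ea' : (-1 : ℂ) ^ a ≠ 0 := by simp
    have := pow_ne_zero (a + b + 1) (neg_ne_zero.mpr hne)
    field_simp
    linear_combination ea
  rw [mul_div_right_comm, h3]
  ring

end Rows

/-! ### Dressings and the uniqueness of their rows. -/

section Uniqueness

variable {k : ℕ} {lam : Fin k → ℂ} {n : Fin k → ℕ} {Φ : Fin k → ℂ → Fin 2 → ℂ}

/-- A matrix function with the analytic properties that characterize the Darboux matrix. -/
structure IsDressing (lam : Fin k → ℂ) (n : Fin k → ℕ) (Φ : Fin k → ℂ → Fin 2 → ℂ)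
    (P : ℂ → Matrix (Fin 2) (Fin 2) ℂ) : Prop where
  differentiableAt : ∀ z, (∀ i, z ≠ conj (lam i)) → ∀ r s, DifferentiableAt ℂ (fun z => P z r s) z
  mul_conjTranspose : ∀ z, (∀ i, z ≠ lam i) → (∀ i, z ≠ conj (lam i)) → P z * (P (conj z))ᴴ = 1
  det_eq : ∀ z, (∀ i, z ≠ conj (lam i)) → (P z).det = ∏ i, blaschke (lam i) z ^ n i
  mulVec_isBigO : ∀ j r, (fun z => (P z *ᵥ Φ j z) r) =O[𝓝 (lam j)] fun z => (z - lam j) ^ n j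
  tendsto : ∀ r s, Tendsto (fun z => P z r s) (cocompact ℂ) (𝓝 ((1 : Matrix (Fin 2) (Fin 2) ℂ) r s))

theorem Finset.eventually_nhdsNE_notMem (S : Finset ℂ) (z : ℂ) : ∀ᶠ w in 𝓝[≠] z, w ∉ S := by
  have h : ((S.erase z : Finset ℂ) : Set ℂ)ᶜ ∈ 𝓝 z :=
    (S.erase z).finite_toSet.isClosed.isOpen_compl.mem_nhds (by simp)
  filter_upwards [nhdsWithin_le_nhds h, self_mem_nhdsWithin] with w hw hwz hwS
  exact hw (by simpa using ⟨hwS, hwz⟩)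

theorem isBigO_sub_pow_of_le (μ : ℂ) {m n : ℕ} (h : m ≤ n) :
    (fun z : ℂ => (z - μ) ^ n) =O[𝓝 μ] fun z => (z - μ) ^ m := by
  have hc : ContinuousAt (fun z : ℂ => (z - μ) ^ (n - m)) μ := by fun_prop
  refine ((hc.tendsto.isBigO_one ℂ).mul (Asymptotics.isBigO_refl (fun z => (z - μ) ^ m) _)).congr (fun z => ?_)
    fun z => one_mul _
  rw [← pow_add, Nat.sub_add_cancel h]

theorem tendsto_conj_nhdsNE (a : ℂ) : Tendsto (fun z : ℂ => conj z) (𝓝[≠] (conj a)) (𝓝[≠] a) := by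
  refine tendsto_nhdsWithin_iff.mpr ⟨?_, ?_⟩
  · exact Tendsto.mono_left (by simpa using Complex.continuous_conj.tendsto (conj a)) nhdsWithin_le_nhds
  · filter_upwards [self_mem_nhdsWithin] with z hz h
    exact hz (by simpa using congrArg conj h)

/-- By Cramer, Q = adj(P) / det P, with a pole of order at most m from the determinant. In dimension
two, a component of φ times an entry of u adj(P) is a combination, with bounded coefficients, of u ·
φ and an entry of P φ, both O((z - μ)^m), which cancels the pole. The component of φ used is one
that is nonzero at μ. -/
theorem isBigO_row_mul_inv {P Q : ℂ → Matrix (Fin 2) (Fin 2) ℂ} {u φ : ℂ → Fin 2 → ℂ} {μ : ℂ} {m : ℕ}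
    (hPQ : ∀ᶠ z in 𝓝[≠] μ, P z * Q z = 1) (hP : ∀ r s, ContinuousAt (fun z => P z r s) μ)
    (hu : ∀ s, ContinuousAt (fun z => u z s) μ) (hφ : ContinuousAt φ μ) (hφ0 : φ μ ≠ 0)
    (hdet : (fun z => ((P z).det)⁻¹) =O[𝓝[≠] μ] fun z => ((z - μ) ^ m)⁻¹)
    (hker : ∀ r, (fun z => (P z *ᵥ φ z) r) =O[𝓝 μ] fun z => (z - μ) ^ m)
    (huφ : (fun z => u z ⬝ᵥ φ z) =O[𝓝 μ] fun z => (z - μ) ^ m) (r : Fin 2) :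
    (fun z => (u z ᵥ* Q z) r) =O[𝓝[≠] μ] fun _ => (1 : ℂ) := by
  have hφs : ∀ s, ContinuousAt (fun z => φ z s) μ := fun s => (continuous_apply s).continuousAt.comp hφ
  have hP1 : ∀ r s, (fun z => P z r s) =O[𝓝[≠] μ] fun _ => (1 : ℂ) := fun r s =>
    ((hP r s).tendsto.isBigO_one ℂ).mono nhdsWithin_le_nhds
  have hu1 : ∀ s, (fun z => u z s) =O[𝓝[≠] μ] fun _ => (1 : ℂ) := fun s =>
    ((hu s).tendsto.isBigO_one ℂ).mono nhdsWithin_le_nhds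
  have hk := fun r => (hker r).mono (nhdsWithin_le_nhds (s := {μ}ᶜ))
  have huk := huφ.mono (nhdsWithin_le_nhds (s := {μ}ᶜ))
  have hadj : ∀ᶠ z in 𝓝[≠] μ, Q z = ((P z).det)⁻¹ • (P z).adjugate := by
    filter_upwards [hPQ] with z hz
    rw [← inv_eq_right_inv hz, inv_def, Ring.inverse_eq_inv']
  have fin : ∀ (a : Fin 2) (N : ℂ → ℂ), φ μ a ≠ 0 → N =O[𝓝[≠] μ] (fun z => (z - μ) ^ m) →
      (∀ z, φ z a * (u z ᵥ* (P z).adjugate) r = N z) → (fun z => (u z ᵥ* Q z) r) =O[𝓝[≠] μ] fun _ => (1 : ℂ) := by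
    intro a N ha hN hz
    have h1 : (fun z => (φ z a)⁻¹) =O[𝓝[≠] μ] fun _ => (1 : ℂ) :=
      (((hφs a).inv₀ ha).tendsto.isBigO_one ℂ).mono nhdsWithin_le_nhds
    have h2 := (h1.mul hdet).mul hN
    refine h2.congr' ?_ ?_
    · filter_upwards [hadj, nhdsWithin_le_nhds ((hφs a).eventually_ne ha)] with z hz1 hz2
      rw [hz1, vecMul_smul, Pi.smul_apply, ← hz z, smul_eq_mul]
      field_simp
    · filter_upwards [self_mem_nhdsWithin] with z hz
      rw [one_mul, inv_mul_cancel₀ (pow_ne_zero m (sub_ne_zero.mpr hz))]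
  have one : ∀ {f g : ℂ → ℂ}, f =O[𝓝[≠] μ] (fun _ => (1 : ℂ)) → g =O[𝓝[≠] μ] (fun z => (z - μ) ^ m) →
      (fun z => f z * g z) =O[𝓝[≠] μ] (fun z => (z - μ) ^ m) := fun hf hg => by simpa using hf.mul hg
  obtain ⟨a, ha⟩ := Function.ne_iff.mp hφ0
  fin_cases a <;> fin_cases r
  · refine fin 0 _ ha ((one (hP1 1 1) huk).sub (one (hu1 1) (hk 1))) fun z => ?_
    simp [adjugate_fin_two, vecMul, mulVec, dotProduct, Fin.sum_univ_two]
    ring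
  · refine fin 0 _ ha ((one (hu1 1) (hk 0)).sub (one (hP1 0 1) huk)) fun z => ?_
    simp [adjugate_fin_two, vecMul, mulVec, dotProduct, Fin.sum_univ_two]
    ring
  · refine fin 1 _ ha ((one (hu1 0) (hk 1)).sub (one (hP1 1 0) huk)) fun z => ?_
    simp [adjugate_fin_two, vecMul, mulVec, dotProduct, Fin.sum_univ_two]
    ring
  · refine fin 1 _ ha ((one (hP1 0 0) huk).sub (one (hu1 0) (hk 0))) fun z => ?_
    simp [adjugate_fin_two, vecMul, mulVec, dotProduct, Fin.sum_univ_two]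
    ring

/-- As the λ_i are distinct, only the j-th Blaschke factor vanishes at λ_j. -/
theorem IsDressing.det_inv_isBigO {P : ℂ → Matrix (Fin 2) (Fin 2) ℂ} (hP : IsDressing lam n Φ P)
    (hinj : Function.Injective lam) (hconj : ∀ i j, lam i ≠ conj (lam j)) (j : Fin k) :
    (fun z => ((P z).det)⁻¹) =O[𝓝[≠] (lam j)] fun z => ((z - lam j) ^ n j)⁻¹ := by
  have hc : ContinuousAt (fun z => (z - conj (lam j)) ^ n j *
      ∏ i ∈ Finset.univ.erase j, (blaschke (lam i) z ^ n i)⁻¹) (lam j) := by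
    refine ContinuousAt.mul (by fun_prop) (tendsto_finsetProd _ fun i hi => ?_)
    have h1 := sub_ne_zero.mpr (hconj j i)
    have h2 := sub_ne_zero.mpr (hinj.ne (Finset.ne_of_mem_erase hi).symm)
    refine ContinuousAt.inv₀ ?_ (pow_ne_zero _ (div_ne_zero h2 h1))
    unfold blaschke
    fun_prop (disch := assumption)
  have h := (Asymptotics.isBigO_refl (fun z => ((z - lam j) ^ n j)⁻¹) (𝓝[≠] (lam j))).mul
    ((hc.tendsto.isBigO_one ℂ).mono nhdsWithin_le_nhds)
  simp only [mul_one] at h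
  have hev : ∀ᶠ z in 𝓝 (lam j), ∀ i, z ≠ conj (lam i) :=
    eventually_all.mpr fun i => isOpen_ne.mem_nhds (hconj j i)
  refine h.congr' ?_ EventuallyEq.rfl
  filter_upwards [nhdsWithin_le_nhds hev] with z hz
  rw [hP.det_eq z hz, ← Finset.mul_prod_erase _ _ (Finset.mem_univ j), mul_inv, Finset.prod_inv_distrib, blaschke,
    div_pow, inv_div, div_eq_mul_inv]
  ring

/-- The row times (z - conj λ_j)^(p+1) is the conjugate of the Taylor polynomial of Φ_j of degree p,
evaluated at conj z. P sends Φ_j to O((w - λ_j)^(n_j)) and p + 1 ≤ n_j, so P sends that polynomial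
to O((w - λ_j)^(p+1)); conjugating cancels the pole. -/
theorem isBigO_darbouxRow_vecMul {P : ℂ → Matrix (Fin 2) (Fin 2) ℂ} {j : Fin k} (p : Fin (n j))
    (hΦ : AnalyticAt ℂ (Φ j) (lam j)) (hP : ∀ r s, ContinuousAt (fun z => P z r s) (lam j))
    (hker : ∀ r, (fun z => (P z *ᵥ Φ j z) r) =O[𝓝 (lam j)] fun z => (z - lam j) ^ n j) (r : Fin 2) :
    (fun z => (darbouxRow lam n Φ ⟨j, p⟩ z ᵥ* (P (conj z))ᴴ) r) =O[𝓝[≠] (conj (lam j))] fun _ => (1 : ℂ) := by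
  have hΦs : ∀ s, AnalyticAt ℂ (fun z => Φ j z s) (lam j) := analyticAt_pi_iff.mp hΦ
  set T : Fin 2 → ℂ → ℂ := fun s w => ∑ q ∈ Finset.range (p + 1), taylorCoef (fun z => Φ j z s) (lam j) q * (w - lam j) ^ q
    with hT
  have h1 : (fun w => ∑ s, P w r s * T s w) =O[𝓝 (lam j)] fun w => (w - lam j) ^ ((p : ℕ) + 1) := by
    have h2 := (hker r).trans (isBigO_sub_pow_of_le (lam j) (show (p : ℕ) + 1 ≤ n j from p.2))
    have h3 : ∀ s, (fun w => P w r s * (Φ j w s - T s w)) =O[𝓝 (lam j)] fun w => (w - lam j) ^ ((p : ℕ) + 1) := fun s => by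
      simpa using ((hP r s).tendsto.isBigO_one ℂ).mul (taylorCoef_remainder_isBigO (hΦs s) (p + 1))
    refine (h2.sub (Asymptotics.IsBigO.fun_sum (s := Finset.univ) fun s _ => h3 s)).congr_left fun w => ?_
    rw [mulVec, dotProduct, ← Finset.sum_sub_distrib]
    exact Finset.sum_congr rfl fun s _ => by ring
  have h4 := (h1.mono nhdsWithin_le_nhds).comp_tendsto (tendsto_conj_nhdsNE (lam j))
  have h5 : (fun z => conj (∑ s, P (conj z) r s * T s (conj z))) =O[𝓝[≠] (conj (lam j))]
      fun z => (z - conj (lam j)) ^ ((p : ℕ) + 1) := by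
    refine Asymptotics.isBigO_norm_norm.mp (h4.norm_norm.congr (fun z => ?_) (fun z => ?_))
    · rw [RCLike.norm_conj, Function.comp_apply]
    · rw [← RCLike.norm_conj (_ ^ _)]
      simp
  have h6 := (Asymptotics.isBigO_refl (fun z => ((z - conj (lam j)) ^ ((p : ℕ) + 1))⁻¹) (𝓝[≠] (conj (lam j)))).mul h5
  refine h6.congr' ?_ ?_
  · filter_upwards [self_mem_nhdsWithin] with z hz
    have hz' := sub_ne_zero.mpr hz
    simp only [vecMul, dotProduct, conjTranspose_apply, darbouxRow_apply, map_sum, map_mul, Finset.mul_sum, hT]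
    refine Finset.sum_congr rfl fun s _ => ?_
    rw [Finset.sum_mul]
    refine Finset.sum_congr rfl fun q hq => ?_
    have hq' : q ≤ p := Nat.lt_succ_iff.mp (Finset.mem_range.mp hq)
    rw [taylorVec_apply hΦ, map_pow, map_sub, Complex.conj_conj,
      show (p : ℕ) + 1 = (p - q + 1) + q by omega, pow_add]
    simp only [RCLike.star_def]
    field_simp
  · filter_upwards [self_mem_nhdsWithin] with z hz
    rw [inv_mul_cancel₀ (pow_ne_zero _ (sub_ne_zero.mpr hz))]

theorem IsDressing.row_eq {P : ℂ → Matrix (Fin 2) (Fin 2) ℂ} (hP : IsDressing lam n Φ P)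
    (hinj : Function.Injective lam) (hconj : ∀ i j, lam i ≠ conj (lam j)) (hΦ : ∀ j, AnalyticAt ℂ (Φ j) (lam j))
    (hΦ0 : ∀ j, Φ j (lam j) ≠ 0) (e : Fin 2 → ℂ) (c : (Σ i, Fin (n i)) → ℂ)
    (hu : ∀ j, (fun z => (e + ∑ a, c a • darbouxRow lam n Φ a z) ⬝ᵥ Φ j z) =O[𝓝 (lam j)]
      fun z => (z - lam j) ^ n j) {z : ℂ} (hz : ∀ i, z ≠ conj (lam i)) :
    e + ∑ a, c a • darbouxRow lam n Φ a z = e ᵥ* P z := by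
  set u : ℂ → Fin 2 → ℂ := fun z => e + ∑ a, c a • darbouxRow lam n Φ a z with hudef
  set Q : ℂ → Matrix (Fin 2) (Fin 2) ℂ := fun z => (P (conj z))ᴴ with hQ
  have hconj' : ∀ i j, conj (lam i) ≠ lam j := fun i j h => hconj j i h.symm
  have hudiff : ∀ z, (∀ i, z ≠ conj (lam i)) → ∀ s, DifferentiableAt ℂ (fun z => u z s) z := by
    intro z hz s
    simp only [hudef, Pi.add_apply, Finset.sum_apply, Pi.smul_apply, smul_eq_mul]
    refine (differentiableAt_const _).add (DifferentiableAt.fun_sum fun a _ => ?_)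
    exact (differentiableAt_const _).mul (differentiableAt_darbouxRow a.2 (hz a.1) s)
  have hQdiff : ∀ z, (∀ i, z ≠ lam i) → ∀ r s, DifferentiableAt ℂ (fun z => Q z r s) z := by
    intro z hz r s
    have := hP.differentiableAt (conj z) (fun i h => hz i (by simpa using congrArg conj h)) s r
    have h := this.conj_conj
    rw [Complex.conj_conj] at h
    exact h
  let S : Finset ℂ := Finset.univ.image lam ∪ Finset.univ.image fun i => conj (lam i)
  have hS : ∀ z, z ∉ S ↔ (∀ i, z ≠ lam i) ∧ ∀ i, z ≠ conj (lam i) := by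
    intro z
    simp [S, not_or, eq_comm]
  have hF : ∀ r, ∀ z ∉ S, (u z ᵥ* Q z) r - e r = 0 := by
    intro r
    refine eq_zero_of_removable_of_tendsto_cocompact S (F := fun z => (u z ᵥ* Q z) r - e r) ?_ ?_ ?_
    · intro z hzS
      rw [hS] at hzS
      simp only [vecMul, dotProduct, Fin.sum_univ_two]
      exact (((hudiff z hzS.2 0).mul (hQdiff z hzS.1 0 r)).add
        ((hudiff z hzS.2 1).mul (hQdiff z hzS.1 1 r))).sub (differentiableAt_const _)
    -- At λ_j the pole comes from P⁻¹ and is cancelled by the vanishing hypotheses; at conj λ_j it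
    -- comes from the rows with block index j.
    · intro s hs
      refine Asymptotics.IsBigO.sub ?_ (Asymptotics.isBigO_const_const _ one_ne_zero _)
      simp only [S, Finset.mem_union, Finset.mem_image, Finset.mem_univ, true_and] at hs
      rcases hs with ⟨j, rfl⟩ | ⟨j, rfl⟩
      · have hev := S.eventually_nhdsNE_notMem (lam j)
        refine isBigO_row_mul_inv (P := P) (φ := Φ j) (m := n j) ?_ ?_ ?_ (hΦ j).continuousAt (hΦ0 j)
          (hP.det_inv_isBigO hinj hconj j) (hP.mulVec_isBigO j) (hu j) r
        · filter_upwards [hev] with z hz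
          exact hP.mul_conjTranspose z ((hS z).mp hz).1 ((hS z).mp hz).2
        · exact fun r s => (hP.differentiableAt _ (fun i => hconj j i) r s).continuousAt
        · exact fun s => (hudiff _ (fun i => hconj j i) s).continuousAt
      · have hPc : ∀ r s, ContinuousAt (fun z => P z r s) (lam j) := fun r s =>
          (hP.differentiableAt _ (fun i => hconj j i) r s).continuousAt
        have hQb : ∀ s, (fun z => Q z s r) =O[𝓝[≠] (conj (lam j))] fun _ => (1 : ℂ) := fun s =>
          ((hQdiff _ (fun i => hconj' j i) s r).continuousAt.tendsto.isBigO_one ℂ).mono nhdsWithin_le_nhds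
        have hsplit : ∀ z, (u z ᵥ* Q z) r = (e ᵥ* Q z) r + ∑ a, c a * (darbouxRow lam n Φ a z ᵥ* Q z) r := by
          intro z
          simp only [hudef, add_vecMul, sum_vecMul, smul_vecMul, Pi.add_apply, Finset.sum_apply, Pi.smul_apply,
            smul_eq_mul]
        simp only [hsplit]
        refine Asymptotics.IsBigO.add ?_ (Asymptotics.IsBigO.fun_sum fun a _ => ?_)
        · simp only [vecMul, dotProduct]
          exact Asymptotics.IsBigO.fun_sum fun s _ => (hQb s).const_mul_left _
        · refine Asymptotics.IsBigO.const_mul_left ?_ _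
          obtain ⟨i, p⟩ := a
          by_cases hij : i = j
          · subst hij
            exact isBigO_darbouxRow_vecMul p (hΦ i) hPc (hP.mulVec_isBigO i) r
          · simp only [vecMul, dotProduct]
            refine Asymptotics.IsBigO.fun_sum fun s _ => ?_
            have hne : conj (lam j) ≠ conj (lam i) := fun h => hij (hinj (by simpa using congrArg conj h)).symm
            have h1 := ((differentiableAt_darbouxRow (Φ := Φ) p hne s).continuousAt.tendsto.isBigO_one ℂ).mono
              (nhdsWithin_le_nhds (s := {conj (lam j)}ᶜ))
            simpa using h1.mul (hQb s)
    · have hut : ∀ s, Tendsto (fun z => u z s) (cocompact ℂ) (𝓝 (e s)) := by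
        intro s
        simp only [hudef, Pi.add_apply, Finset.sum_apply, Pi.smul_apply, smul_eq_mul]
        have : Tendsto (fun z => e s + ∑ a, c a * darbouxRow lam n Φ a z s) (cocompact ℂ) (𝓝 (e s + ∑ a, c a * 0)) :=
          tendsto_const_nhds.add (tendsto_finsetSum _ fun a _ => (tendsto_darbouxRow_cocompact a s).const_mul _)
        simpa using this
      have hQt : ∀ r s, Tendsto (fun z => Q z r s) (cocompact ℂ) (𝓝 ((1 : Matrix (Fin 2) (Fin 2) ℂ) r s)) := by
        intro r s
        have h1 : Tendsto (fun z : ℂ => conj z) (cocompact ℂ) (cocompact ℂ) :=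
          (Complex.conjCLE.toHomeomorph).isClosedEmbedding.tendsto_cocompact
        have h2 := (Complex.continuous_conj.tendsto _).comp ((hP.tendsto s r).comp h1)
        have h3 : conj ((1 : Matrix (Fin 2) (Fin 2) ℂ) s r) = (1 : Matrix (Fin 2) (Fin 2) ℂ) r s := by
          simp [one_apply, eq_comm, apply_ite]
        rwa [h3] at h2
      have h := (((hut 0).mul (hQt 0 r)).add ((hut 1).mul (hQt 1 r))).sub_const (e r)
      have he : ∀ r, e 0 * (1 : Matrix (Fin 2) (Fin 2) ℂ) 0 r + e 1 * (1 : Matrix (Fin 2) (Fin 2) ℂ) 1 r - e r = 0 :=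
        Fin.forall_fin_two.mpr ⟨by simp, by simp⟩
      rw [he] at h
      simpa only [vecMul, dotProduct, Fin.sum_univ_two] using h
  have hoff : ∀ w ∉ S, u w = e ᵥ* P w := by
    intro w hw
    have h1 : u w ᵥ* Q w = e := funext fun r => sub_eq_zero.mp (hF r w hw)
    have h2 : Q w * P w = 1 := mul_eq_one_comm.mp (hP.mul_conjTranspose w ((hS w).mp hw).1 ((hS w).mp hw).2)
    rw [← h1, vecMul_vecMul, h2, vecMul_one]
  funext s
  -- The identity is known off the λ_i and their conjugates; continuity extends it to the points
  -- λ_i.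
  have hc1 : Tendsto (fun w => u w s) (𝓝[≠] z) (𝓝 (u z s)) :=
    (hudiff z hz s).continuousAt.tendsto.mono_left nhdsWithin_le_nhds
  have hc2 : Tendsto (fun w => (e ᵥ* P w) s) (𝓝[≠] z) (𝓝 ((e ᵥ* P z) s)) := by
    refine Tendsto.mono_left ?_ (nhdsWithin_le_nhds (s := {z}ᶜ))
    simp only [vecMul, dotProduct, Fin.sum_univ_two]
    exact ((hP.differentiableAt z hz 0 s).continuousAt.tendsto.const_mul _).add
      ((hP.differentiableAt z hz 1 s).continuousAt.tendsto.const_mul _)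
  refine tendsto_nhds_unique_of_eventuallyEq hc1 hc2 ?_
  filter_upwards [S.eventually_nhdsNE_notMem z] with w hw
  rw [hoff w hw]

end Uniqueness

/-! ### Invertibility of M and identification of T_N. -/

section Invertibility

variable {k : ℕ} {lam : Fin k → ℂ} {n : Fin k → ℕ} {Φ : Fin k → ℂ → Fin 2 → ℂ}

theorem analyticAt_darbouxRow_apply (hconj : ∀ i j, lam i ≠ conj (lam j)) (a : Σ i, Fin (n i)) (j : Fin k) (s : Fin 2) :
    AnalyticAt ℂ (fun z => darbouxRow lam n Φ a z s) (lam j) := by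
  refine DifferentiableOn.analyticAt (s := {z | z ≠ conj (lam a.1)}) (fun z hz => ?_) (isOpen_ne.mem_nhds (hconj j a.1))
  exact (differentiableAt_darbouxRow a.2 hz s).differentiableWithinAt

theorem row_dotProduct_isBigO (hconj : ∀ i j, lam i ≠ conj (lam j)) (hΦ : ∀ j, AnalyticAt ℂ (Φ j) (lam j))
    (e : Fin 2 → ℂ) (c : (Σ i, Fin (n i)) → ℂ)
    (hc : ∀ j (q : Fin (n j)), e ⬝ᵥ taylorVec (Φ j) (lam j) q = ∑ a, c a * darbouxM lam n Φ a ⟨j, q⟩) (j : Fin k) :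
    (fun z => (e + ∑ a, c a • darbouxRow lam n Φ a z) ⬝ᵥ Φ j z) =O[𝓝 (lam j)] fun z => (z - lam j) ^ n j := by
  have hΦs : ∀ s, AnalyticAt ℂ (fun z => Φ j z s) (lam j) := analyticAt_pi_iff.mp (hΦ j)
  have hR : ∀ a, AnalyticAt ℂ (fun z => darbouxRow lam n Φ a z ⬝ᵥ Φ j z) (lam j) := fun a =>
    Finset.analyticAt_fun_sum _ fun s _ => (analyticAt_darbouxRow_apply hconj a j s).mul (hΦs s)
  have hE : AnalyticAt ℂ (fun z => e ⬝ᵥ Φ j z) (lam j) :=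
    Finset.analyticAt_fun_sum _ fun s _ => analyticAt_const.mul (hΦs s)
  have hsum : AnalyticAt ℂ (fun z => ∑ a, c a * (darbouxRow lam n Φ a z ⬝ᵥ Φ j z)) (lam j) :=
    Finset.analyticAt_fun_sum _ fun a _ => analyticAt_const.mul (hR a)
  have heq : (fun z => (e + ∑ a, c a • darbouxRow lam n Φ a z) ⬝ᵥ Φ j z)
      = fun z => e ⬝ᵥ Φ j z + ∑ a, c a * (darbouxRow lam n Φ a z ⬝ᵥ Φ j z) := by
    funext z
    simp only [add_dotProduct, sum_dotProduct, smul_dotProduct, smul_eq_mul]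
  rw [heq]
  refine isBigO_pow_of_taylorCoef_eq_zero (hE.add hsum) fun q hq => ?_
  rw [taylorCoef_add hE hsum, taylorCoef_sum (f := fun a z => c a * (darbouxRow lam n Φ a z ⬝ᵥ Φ j z)) _
    fun a _ => analyticAt_const.mul (hR a)]
  have h1 : taylorCoef (fun z => e ⬝ᵥ Φ j z) (lam j) q = e ⬝ᵥ taylorVec (Φ j) (lam j) q := by
    simp only [dotProduct, taylorVec_apply (hΦ j)]
    rw [taylorCoef_sum (f := fun s z => e s * Φ j z s) _ fun s _ => analyticAt_const.mul (hΦs s)]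
    exact Finset.sum_congr rfl fun s _ => taylorCoef_const_mul _ _ _ _
  rw [h1, hc j ⟨q, hq⟩, ← Finset.sum_add_distrib]
  refine Finset.sum_eq_zero fun a _ => ?_
  rw [taylorCoef_const_mul, taylorCoef_darbouxRow_dotProduct hΦ hconj a.1 j a.2 ⟨q, hq⟩]
  ring

theorem tendsto_pow_mul_darbouxRow (j : Fin k) (p p' : Fin (n j)) (h : p' ≤ p) (s : Fin 2) :
    Tendsto (fun z => (z - conj (lam j)) ^ ((p : ℕ) + 1) * darbouxRow lam n Φ ⟨j, p'⟩ z s) (𝓝[≠] (conj (lam j)))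
      (𝓝 (if p' = p then conj (Φ j (lam j) s) else 0)) := by
  have hc : Continuous fun z => ∑ q ∈ Finset.range (p' + 1),
      (z - conj (lam j)) ^ ((p : ℕ) - p' + q) * conj (taylorVec (Φ j) (lam j) q s) := by fun_prop
  have hv : ∑ q ∈ Finset.range (p' + 1),
      (conj (lam j) - conj (lam j)) ^ ((p : ℕ) - p' + q) * conj (taylorVec (Φ j) (lam j) q s)
        = if p' = p then conj (Φ j (lam j) s) else 0 := by
    rw [sub_self, Finset.sum_eq_single 0]
    · split_ifs with hp
      · subst hp
        simp [taylorVec_zero]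
      · have : (p : ℕ) - p' ≠ 0 := by
          have := Fin.le_def.mp h
          have := Fin.val_ne_of_ne hp
          omega
        simp [this]
    · intro q _ hq
      simp [hq]
    · simp
  rw [← hv]
  refine ((hc.tendsto _).mono_left (nhdsWithin_le_nhds (s := {conj (lam j)}ᶜ))).congr' ?_
  filter_upwards [self_mem_nhdsWithin] with z hz
  have hz' := sub_ne_zero.mpr hz
  rw [darbouxRow_apply, Finset.mul_sum]
  refine Finset.sum_congr rfl fun q hq => ?_
  have hq' : q ≤ p' := Nat.lt_succ_iff.mp (Finset.mem_range.mp hq)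
  have h' := Fin.le_def.mp h
  rw [← mul_assoc]
  congr 1
  rw [mul_one_div, eq_div_iff (pow_ne_zero _ hz'), ← pow_add]
  congr 1
  omega

/-- The leading coefficient of row (j, p) at conj λ_j is conj Φ_j(λ_j) ≠ 0, with a pole of order p +
1. Poles at different conj λ_j do not interact, so coefficients can be peeled off from the highest
order downwards. -/
theorem coef_eq_zero_of_sum_darbouxRow_eq_zero (hinj : Function.Injective lam) (hΦ0 : ∀ j, Φ j (lam j) ≠ 0)
    (c : (Σ i, Fin (n i)) → ℂ) (h : ∀ z, (∀ i, z ≠ conj (lam i)) → ∑ a, c a • darbouxRow lam n Φ a z = 0) :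
    c = 0 := by
  -- Descending induction on p: d bounds the distance n_j - p, and d = 0 is vacuous.
  suffices H : ∀ j, ∀ d, ∀ p : Fin (n j), n j ≤ p + d → c ⟨j, p⟩ = 0 from
    funext fun a => H a.1 (n a.1) a.2 (by omega)
  intro j d
  induction d with
  | zero => exact fun p hp => absurd p.2 (by omega)
  | succ d ih =>
    intro p hp
    obtain ⟨s, hs⟩ := Function.ne_iff.mp (hΦ0 j)
    have hterm : ∀ a, Tendsto (fun z => (z - conj (lam j)) ^ ((p : ℕ) + 1) * (c a * darbouxRow lam n Φ a z s))
        (𝓝[≠] (conj (lam j))) (𝓝 (if a = ⟨j, p⟩ then c a * conj (Φ j (lam j) s) else 0)) := by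
      rintro ⟨i, p'⟩
      by_cases hij : i = j
      · subst hij
        by_cases hpp : p' ≤ p
        · have h1 := (tendsto_pow_mul_darbouxRow (lam := lam) (Φ := Φ) i p p' hpp s).const_mul (c ⟨i, p'⟩)
          have h2 : (if (⟨i, p'⟩ : Σ i, Fin (n i)) = ⟨i, p⟩ then c ⟨i, p'⟩ * conj (Φ i (lam i) s) else 0)
              = c ⟨i, p'⟩ * if p' = p then conj (Φ i (lam i) s) else 0 := by
            by_cases hpe : p' = p <;> simp [hpe]
          rw [h2]
          refine h1.congr fun z => ?_
          ring
        · have hc0 : c ⟨i, p'⟩ = 0 := ih p' (by have := Fin.le_def.not.mp hpp; omega)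
          simp [hc0]
      · have hne : conj (lam j) ≠ conj (lam i) := fun h => hij (hinj (by simpa using congrArg conj h)).symm
        have h1 := (differentiableAt_darbouxRow (n := n) (Φ := Φ) p' hne s).continuousAt.tendsto
        have h2 : Tendsto (fun z => (z - conj (lam j)) ^ ((p : ℕ) + 1)) (𝓝 (conj (lam j))) (𝓝 0) := by
          have : Continuous fun z => (z - conj (lam j)) ^ ((p : ℕ) + 1) := by fun_prop
          simpa using this.tendsto (conj (lam j))
        have h3 := (h2.mul (h1.const_mul (c ⟨i, p'⟩))).mono_left (nhdsWithin_le_nhds (s := {conj (lam j)}ᶜ))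
        rw [zero_mul] at h3
        rw [if_neg fun he => hij (congrArg Sigma.fst he)]
        exact h3
    have hlim := tendsto_finsetSum Finset.univ fun a _ => hterm a
    rw [Finset.sum_ite_eq' Finset.univ, if_pos (Finset.mem_univ _)] at hlim
    have hz0 : (fun z => ∑ a, (z - conj (lam j)) ^ ((p : ℕ) + 1) * (c a * darbouxRow lam n Φ a z s))
        =ᶠ[𝓝[≠] (conj (lam j))] fun _ => 0 := by
      filter_upwards [(Finset.univ.image fun i => conj (lam i)).eventually_nhdsNE_notMem (conj (lam j))] with z hz
      have := congrFun (h z fun i hi => hz (Finset.mem_image.mpr ⟨i, Finset.mem_univ _, hi.symm⟩)) s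
      simp only [Finset.sum_apply, Pi.smul_apply, smul_eq_mul, Pi.zero_apply] at this
      rw [← Finset.mul_sum, this, mul_zero]
    have h0 := tendsto_nhds_unique_of_eventuallyEq hlim tendsto_const_nhds hz0
    exact (mul_eq_zero.mp h0).resolve_right (by simpa using hs)

variable {P : ℂ → Matrix (Fin 2) (Fin 2) ℂ}

theorem IsDressing.isUnit_det_darbouxM (hP : IsDressing lam n Φ P) (hinj : Function.Injective lam)
    (hconj : ∀ i j, lam i ≠ conj (lam j)) (hΦ : ∀ j, AnalyticAt ℂ (Φ j) (lam j)) (hΦ0 : ∀ j, Φ j (lam j) ≠ 0) :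
    IsUnit (darbouxM lam n Φ).det := by
  rw [isUnit_iff_ne_zero]
  intro hdet
  obtain ⟨c, hc0, hc⟩ := exists_vecMul_eq_zero_iff.mpr hdet
  refine hc0 (coef_eq_zero_of_sum_darbouxRow_eq_zero hinj hΦ0 c fun z hz => ?_)
  have h := hP.row_eq hinj hconj hΦ hΦ0 0 c (row_dotProduct_isBigO hconj hΦ 0 c fun j q => ?_) hz
  · simpa using h
  · rw [zero_dotProduct]
    exact (congrFun hc ⟨j, q⟩).symm

theorem IsDressing.darbouxT_eq (hP : IsDressing lam n Φ P) (hinj : Function.Injective lam)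
    (hconj : ∀ i j, lam i ≠ conj (lam j)) (hΦ : ∀ j, AnalyticAt ℂ (Φ j) (lam j)) (hΦ0 : ∀ j, Φ j (lam j) ≠ 0)
    {z : ℂ} (hz : ∀ i, z ≠ conj (lam i)) : darbouxT lam n Φ z = P z := by
  have hM := hP.isUnit_det_darbouxM hinj hconj hΦ hΦ0
  ext r s
  -- With e the r-th basis vector, the system c M = e Y is solved by the r-th row of Y M⁻¹.
  have h := hP.row_eq hinj hconj hΦ hΦ0 ((1 : Matrix (Fin 2) (Fin 2) ℂ) r)
    (fun a => (darbouxY lam n Φ * (darbouxM lam n Φ)⁻¹) r a) (row_dotProduct_isBigO hconj hΦ _ _ fun j q => ?_) hz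
  · have hs := congrFun h s
    rw [darbouxT, Matrix.mul_assoc (_ * _), Matrix.add_apply, Matrix.mul_apply]
    simp only [Pi.add_apply, Finset.sum_apply, Pi.smul_apply, smul_eq_mul] at hs
    refine hs.trans ?_
    change ((1 : Matrix (Fin 2) (Fin 2) ℂ) * P z) r s = _
    rw [Matrix.one_mul]
  · have h1 : darbouxY lam n Φ * (darbouxM lam n Φ)⁻¹ * darbouxM lam n Φ = darbouxY lam n Φ := by
      rw [Matrix.mul_assoc, nonsing_inv_mul _ hM, Matrix.mul_one]
    have h2 := congrFun (congrFun h1 r) ⟨j, q⟩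
    rw [Matrix.mul_apply] at h2
    rw [h2]
    simp [darbouxY, dotProduct, one_apply]

end Invertibility

/-! ### The two iterated products are dressings. -/

section Products

theorem analyticAt_darbouxBlock_mulVec {μ w : ℂ} {ψ φ : ℂ → Fin 2 → ℂ} (m : ℕ) (h : w ≠ conj μ)
    (hφ : AnalyticAt ℂ φ w) : AnalyticAt ℂ (fun z => darbouxBlock μ ψ m z *ᵥ φ z) w := by
  have hφs : ∀ s, AnalyticAt ℂ (fun z => φ z s) w := analyticAt_pi_iff.mp hφ
  have hB : ∀ r s, AnalyticAt ℂ (fun z => darbouxBlock μ ψ m z r s) w := fun r s =>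
    DifferentiableOn.analyticAt (s := {z | z ≠ conj μ})
      (fun z hz => (differentiableAt_darbouxBlock μ ψ m hz r s).differentiableWithinAt) (isOpen_ne.mem_nhds h)
  refine analyticAt_pi_iff.mpr fun r => ?_
  simp only [mulVec, dotProduct]
  exact Finset.analyticAt_fun_sum _ fun s _ => (hB r s).mul (hφs s)

theorem darbouxBlock_mulVec_ne_zero {μ w : ℂ} {ψ : ℂ → Fin 2 → ℂ} {m : ℕ} (hψ : ∀ j < m, iterVec μ ψ j ≠ 0)
    (h : w ≠ μ) (h' : w ≠ conj μ) {v : Fin 2 → ℂ} (hv : v ≠ 0) : darbouxBlock μ ψ m w *ᵥ v ≠ 0 := by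
  refine fun h0 => hv (eq_zero_of_mulVec_eq_zero ?_ h0)
  rw [det_darbouxBlock hψ h']
  exact pow_ne_zero _ (div_ne_zero (sub_ne_zero.mpr h) (sub_ne_zero.mpr h'))

variable {lam : Fin 2 → ℂ} {n : Fin 2 → ℕ} {Φ : Fin 2 → ℂ → Fin 2 → ℂ}

theorem analyticAt_dressedVec (hconj : ∀ i j, lam i ≠ conj (lam j)) (hΦ : ∀ j, AnalyticAt ℂ (Φ j) (lam j))
    (i j : Fin 2) : AnalyticAt ℂ (dressedVec lam n Φ i j) (lam i) :=
  analyticAt_darbouxBlock_mulVec _ (hconj i j) (hΦ i)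

theorem dressedVec_ne_zero (hinj : Function.Injective lam) (hconj : ∀ i j, lam i ≠ conj (lam j))
    (hΦ : ∀ j, AnalyticAt ℂ (Φ j) (lam j)) (hΦ0 : ∀ j, Φ j (lam j) ≠ 0) {i j : Fin 2} (hij : i ≠ j) :
    dressedVec lam n Φ i j (lam i) ≠ 0 :=
  darbouxBlock_mulVec_ne_zero (fun m hm => (iterationDefined (hconj j j) (hΦ j) (hΦ0 j) _ m hm).2) (hinj.ne hij)
    (hconj i j) (hΦ0 i)

theorem isDressing_outerBlock_mul_innerBlock (hinj : Function.Injective lam) (hconj : ∀ i j, lam i ≠ conj (lam j))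
    (hΦ : ∀ j, AnalyticAt ℂ (Φ j) (lam j)) (hΦ0 : ∀ j, Φ j (lam j) ≠ 0) {i j : Fin 2} (hij : i ≠ j) :
    IsDressing lam n Φ fun z => outerBlock lam n Φ i j z * innerBlock lam n Φ j z := by
  have hor : ∀ m, m = i ∨ m = j := fun m => by omega
  have huniv : (Finset.univ : Finset (Fin 2)) = {i, j} := by
    ext m
    simpa using hor m
  have hD := analyticAt_dressedVec (n := n) hconj hΦ i j
  have hD0 := dressedVec_ne_zero (n := n) hinj hconj hΦ hΦ0 hij
  refine ⟨fun z hz => ?_, fun z hz hz' => ?_, fun z hz => ?_, fun m r => ?_, fun r s => ?_⟩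
  · exact differentiableAt_mul_apply (differentiableAt_darbouxBlock _ _ _ (hz i))
      (differentiableAt_darbouxBlock _ _ _ (hz j))
  · rw [conjTranspose_mul, Matrix.mul_assoc, ← Matrix.mul_assoc _ _ (_ᴴ), innerBlock,
      darbouxBlock_mul_conjTranspose _ (hz j) (hz' j), Matrix.one_mul, outerBlock,
      darbouxBlock_mul_conjTranspose _ (hz i) (hz' i)]
  · rw [det_mul, huniv, Finset.prod_pair hij, outerBlock, innerBlock,
      det_darbouxBlock (fun m hm => (iterationDefined (hconj i i) hD hD0 _ m hm).2) (hz i),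
      det_darbouxBlock (fun m hm => (iterationDefined (hconj j j) (hΦ j) (hΦ0 j) _ m hm).2) (hz j)]
  · simp only [← mulVec_mulVec]
    rcases hor m with rfl | rfl
    -- At the outer parameter the vanishing is that of the outer block on the dressed vector; at the
    -- inner one it comes from the inner block, and the outer block is bounded there.
    · exact darbouxBlock_mulVec_isBigO (hconj m m) hD (n m) r
    · conv => enter [2, z]; rw [mulVec, dotProduct]
      refine Asymptotics.IsBigO.fun_sum fun s _ => ?_
      have h1 := (differentiableAt_darbouxBlock (lam i) (dressedVec lam n Φ i m) (n i)
        (hconj m i) r s).continuousAt.tendsto.isBigO_one ℂ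
      have h2 := h1.mul (darbouxBlock_mulVec_isBigO (hconj m m) (hΦ m) (n m) s)
      simp only [one_mul] at h2
      exact h2
  · rw [← Matrix.one_mul (1 : Matrix (Fin 2) (Fin 2) ℂ)]
    exact tendsto_mul_apply (tendsto_darbouxBlock_cocompact _ _ _) (tendsto_darbouxBlock_cocompact _ _ _) r s

end Products

/-- The limit vectors only pick up the factor c(μ), to which the projectors are blind. This permits
normalizing either component of the wave vector to 1. -/
theorem darbouxBlock_smul {μ : ℂ} {ψ : ℂ → Fin 2 → ℂ} (hμ : μ ≠ conj μ) (hψ : AnalyticAt ℂ ψ μ) {c : ℂ → ℂ}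
    (hc : ContinuousAt c μ) (hc0 : c μ ≠ 0) (m : ℕ) :
    darbouxBlock μ (fun z => c z • ψ z) m = darbouxBlock μ ψ m := by
  induction m with
  | zero => rfl
  | succ m ih =>
    have h1 := (iterVec_and_block hμ hψ m).2
    rw [← iterVec_eq hμ hψ m] at h1
    have h2 : Tendsto (fun ε => c (μ + ε)) (𝓝[≠] 0) (𝓝 (c μ)) := by
      have : ContinuousAt (fun ε => c (μ + ε)) 0 := ContinuousAt.comp (by simpa using hc) (by fun_prop)
      simpa using this.tendsto.mono_left nhdsWithin_le_nhds
    have h3 : iterVec μ (fun z => c z • ψ z) m = c μ • iterVec μ ψ m := by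
      refine Tendsto.limUnder_eq ((h2.smul h1).congr fun ε => ?_)
      rw [ih, iterQuot, iterQuot, mulVec_smul, smul_comm]
    funext z
    rw [darbouxBlock_succ, darbouxBlock_succ, h3, elemDarboux_smul hc0, ih]

/-! ### Perturbation of the iteration around a coordinate vector. -/

section Perturbation

variable {ι : Type*} {l : Filter ι} {s : ι → ℝ}

theorem rankOneProj_isBigO {v : ι → Fin 2 → ℂ} {a b : Fin 2} (hab : a ≠ b) (hs : Tendsto s l (𝓝 0))
    (ha : (fun τ => v τ a) =O[l] s) (hb : Tendsto (fun τ => v τ b) l (𝓝 1)) (p q : Fin 2) :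
    (fun τ => rankOneProj (v τ) p q - if p = b ∧ q = b then 1 else 0) =O[l] s := by
  have hstar : ∀ {f : ι → ℂ} {g : ι → ℝ}, f =O[l] g → (fun τ => conj (f τ)) =O[l] g := fun h =>
    h.norm_left.congr_left (fun τ => (RCLike.norm_conj _).symm) |>.of_norm_left
  have hb1 : (fun τ => v τ b) =O[l] fun _ => (1 : ℝ) := hb.isBigO_one ℝ
  have ha1 : (fun τ => v τ a) =O[l] fun _ => (1 : ℝ) := ha.trans (hs.isBigO_one ℝ)
  have hne : ∀ᶠ τ in l, v τ b ≠ 0 := hb.eventually_ne one_ne_zero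
  have hnorm : ∀ τ, star (v τ) ⬝ᵥ v τ = conj (v τ a) * v τ a + conj (v τ b) * v τ b := fun τ => by
    fin_cases a <;> fin_cases b <;> first | exact absurd rfl hab | simp [dotProduct, Fin.sum_univ_two, add_comm]
  have hinv : (fun τ => (star (v τ) ⬝ᵥ v τ)⁻¹) =O[l] fun _ => (1 : ℝ) := by
    have h0 : Tendsto (fun τ => v τ a) l (𝓝 0) := ha.trans_tendsto hs
    have hc : ∀ {c : ℂ} {f : ι → ℂ}, Tendsto f l (𝓝 c) → Tendsto (fun τ => conj (f τ)) l (𝓝 (conj c)) := fun h =>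
      (Complex.continuous_conj.tendsto _).comp h
    have h1 := ((hc h0).mul h0).add ((hc hb).mul hb)
    simp only [← hnorm] at h1
    exact (h1.inv₀ (by simp)).isBigO_one ℝ
  have hPaa : (fun τ => (star (v τ) ⬝ᵥ v τ)⁻¹ * (v τ a * conj (v τ a))) =O[l] s := by
    simpa using hinv.mul (ha.mul (hstar ha1))
  have hPab : (fun τ => (star (v τ) ⬝ᵥ v τ)⁻¹ * (v τ a * conj (v τ b))) =O[l] s := by
    simpa using hinv.mul (ha.mul (hstar hb1))
  have hPba : (fun τ => (star (v τ) ⬝ᵥ v τ)⁻¹ * (v τ b * conj (v τ a))) =O[l] s := by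
    simpa using hinv.mul (hb1.mul (hstar ha))
  have hor : ∀ p, p = a ∨ p = b := fun p => by omega
  have hP : ∀ τ p q, rankOneProj (v τ) p q = (star (v τ) ⬝ᵥ v τ)⁻¹ * (v τ p * conj (v τ q)) := fun τ p q => rfl
  rcases hor p with rfl | rfl <;> rcases hor q with rfl | rfl
  · simpa [hP, hab] using hPaa
  · simpa [hP, hab] using hPab
  · simpa [hP, hab] using hPba
  -- The projector has trace 1, so its (b, b) entry differs from 1 by minus the (a, a) entry.
  · refine hPaa.neg_left.congr' ?_ EventuallyEq.rfl
    filter_upwards [hne] with τ hτ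
    have h0 : star (v τ) ⬝ᵥ v τ ≠ 0 := star_dotProduct_self_ne_zero fun h => hτ (by rw [h]; rfl)
    rw [hP]
    simp only [and_self, if_true]
    field_simp
    rw [hnorm]
    ring

variable {μ : ℂ} {ψ : ι → ℂ → Fin 2 → ℂ} {a b : Fin 2}

/-- The divided difference shifts Taylor indices by one, so each step uses up one coefficient; hence
the range m + j < N. The projector 1 - P is near the one on the a-axis, so the a-component stays
O(s) and the b-component changes only by O(s). -/
theorem taylorVec_reducedVec_isBigO (hab : a ≠ b) (hs : Tendsto s l (𝓝 0)) (hψ : ∀ τ, AnalyticAt ℂ (ψ τ) μ) (N : ℕ)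
    (ha : ∀ m < N, (fun τ => taylorVec (ψ τ) μ m a) =O[l] s)
    (hb : ∀ m < N, (fun τ => taylorVec (ψ τ) μ m b) =O[l] fun _ => (1 : ℝ))
    (hb0 : Tendsto (fun τ => taylorVec (ψ τ) μ 0 b) l (𝓝 1)) (j : ℕ) (hj : j < N) :
    (∀ m, m + j < N → (fun τ => taylorVec (reducedVec μ (ψ τ) j) μ m a) =O[l] s) ∧
    (∀ m, m + j < N → (fun τ => taylorVec (reducedVec μ (ψ τ) j) μ m b) =O[l] fun _ => (1 : ℝ)) ∧
    Tendsto (fun τ => taylorVec (reducedVec μ (ψ τ) j) μ 0 b) l (𝓝 1) := by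
  have hs1 : s =O[l] fun _ => (1 : ℝ) := hs.isBigO_one ℝ
  have hor : ∀ p, p = a ∨ p = b := fun p => by omega
  have hsum : ∀ f : Fin 2 → ℂ, ∑ p, f p = f a + f b := fun f => by
    rw [show (Finset.univ : Finset (Fin 2)) = {a, b} by ext m; simpa using hor m, Finset.sum_pair hab]
  induction j with
  | zero => exact ⟨fun m hm => ha m hm, fun m hm => hb m hm, hb0⟩
  | succ j ih =>
    obtain ⟨iha, ihb, ihb0⟩ := ih (by omega)
    have hrec : ∀ τ m p, taylorVec (reducedVec μ (ψ τ) (j + 1)) μ m p = taylorVec (reducedVec μ (ψ τ) j) μ m p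
        + (μ - conj μ) * (∑ q, (1 - rankOneProj (taylorVec (reducedVec μ (ψ τ) j) μ 0)) p q
          * taylorVec (reducedVec μ (ψ τ) j) μ (m + 1) q) := by
      intro τ m p
      have hA := analyticAt_reducedVec (hψ τ) j
      rw [taylorVec_zero, reducedVec, taylorVec_add hA (hA.dslope.const_mulVec _),
        taylorVec_const_mulVec _ hA.dslope, taylorVec_dslope hA, smul_mulVec]
      rfl
    have hP := rankOneProj_isBigO hab hs (iha 0 (by omega)) ihb0
    have h1 : ∀ p q, ¬(p = a ∧ q = a) →
        (fun τ => (1 - rankOneProj (taylorVec (reducedVec μ (ψ τ) j) μ 0)) p q) =O[l] s := by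
      intro p q hpq
      refine (hP p q).neg_left.congr_left fun τ => ?_
      have h3 : (1 : Matrix (Fin 2) (Fin 2) ℂ) p q = if p = b ∧ q = b then 1 else 0 := by
        rcases hor p with rfl | rfl <;> rcases hor q with rfl | rfl <;> simp_all [one_apply]
      rw [Matrix.sub_apply, h3]
      ring
    have h2 : (fun τ => (1 - rankOneProj (taylorVec (reducedVec μ (ψ τ) j) μ 0)) a a) =O[l] fun _ => (1 : ℝ) := by
      refine ((Asymptotics.isBigO_const_const (1 : ℂ) one_ne_zero l).sub ((hP a a).trans hs1)).congr_left fun τ => ?_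
      simp [hab]
    have hbb : ∀ m, m + (j + 1) < N → (fun τ => (μ - conj μ) *
        (∑ q, (1 - rankOneProj (taylorVec (reducedVec μ (ψ τ) j) μ 0)) b q
          * taylorVec (reducedVec μ (ψ τ) j) μ (m + 1) q)) =O[l] s := by
      intro m hm
      refine Asymptotics.IsBigO.const_mul_left ?_ _
      simp only [hsum]
      refine Asymptotics.IsBigO.add ?_ ?_
      · simpa using (h1 b a (by simp [hab.symm])).mul ((iha (m + 1) (by omega)).trans hs1)
      · simpa using (h1 b b (by simp [hab.symm])).mul (ihb (m + 1) (by omega))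
    refine ⟨fun m hm => ?_, fun m hm => ?_, ?_⟩
    · simp only [hrec]
      refine (iha m (by omega)).add (Asymptotics.IsBigO.const_mul_left ?_ _)
      simp only [hsum]
      refine Asymptotics.IsBigO.add ?_ ?_
      · simpa using h2.mul (iha (m + 1) (by omega))
      · simpa using (h1 a b (by simp [hab.symm])).mul (ihb (m + 1) (by omega))
    · simp only [hrec]
      exact (ihb m (by omega)).add ((hbb m hm).trans hs1)
    · simp only [hrec]
      simpa using ihb0.add ((hbb 0 (by omega)).trans_tendsto hs)

theorem darbouxBlock_sub_diagonal_isBigO (hμ : μ ≠ conj μ) (hab : a ≠ b) (hs : Tendsto s l (𝓝 0))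
    (hψ : ∀ τ, AnalyticAt ℂ (ψ τ) μ) (N : ℕ)
    (ha : ∀ m < N, (fun τ => taylorVec (ψ τ) μ m a) =O[l] s)
    (hb : ∀ m < N, (fun τ => taylorVec (ψ τ) μ m b) =O[l] fun _ => (1 : ℝ))
    (hb0 : Tendsto (fun τ => taylorVec (ψ τ) μ 0 b) l (𝓝 1))
    {ζ : ι → ℂ} (hζ : ∀ᶠ τ in l, ζ τ ≠ conj μ) (hζ' : (fun τ => (ζ τ - conj μ)⁻¹) =O[l] fun _ => (1 : ℝ))
    (j : ℕ) (hj : j ≤ N) (p q : Fin 2) :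
    (fun τ => (darbouxBlock μ (ψ τ) j (ζ τ)
      - diagonal (fun r => if r = b then blaschke μ (ζ τ) ^ j else 1)) p q) =O[l] s := by
  have hs1 : s =O[l] fun _ => (1 : ℝ) := hs.isBigO_one ℝ
  have hor : ∀ p, p = a ∨ p = b := fun p => by omega
  have hκ : (fun τ => (μ - conj μ) / (ζ τ - conj μ)) =O[l] fun _ => (1 : ℝ) := by
    simpa [div_eq_mul_inv] using hζ'.const_mul_left (μ - conj μ)
  have hbl : ∀ᶠ τ in l, blaschke μ (ζ τ) = 1 - (μ - conj μ) / (ζ τ - conj μ) := by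
    filter_upwards [hζ] with τ hτ
    have := sub_ne_zero.mpr hτ
    rw [blaschke]
    field_simp
    ring
  have hbO : (fun τ => blaschke μ (ζ τ)) =O[l] fun _ => (1 : ℝ) :=
    ((Asymptotics.isBigO_const_const (1 : ℂ) one_ne_zero l).sub hκ).congr' (hbl.mono fun τ h => h.symm) EventuallyEq.rfl
  have hL : ∀ (j : ℕ) p q, (fun τ => diagonal (fun r => if r = b then blaschke μ (ζ τ) ^ j else 1) p q)
      =O[l] fun _ => (1 : ℝ) := by
    intro j p q
    by_cases hpq : p = q
    · subst hpq
      by_cases hp : p = b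
      · simpa [hp] using hbO.pow j
      · simpa [hp] using Asymptotics.isBigO_const_const (1 : ℂ) (one_ne_zero (α := ℝ)) l
    · exact (Asymptotics.isBigO_zero (E' := ℂ) (fun _ => (1 : ℝ)) l).congr_left fun τ => by simp [hpq]
  induction j generalizing p q with
  | zero => exact (Asymptotics.isBigO_zero (E' := ℂ) s l).congr_left fun τ => by simp [darbouxBlock_zero]
  | succ j ih =>
    have ih' := ih (by omega)
    obtain ⟨h1, -, h3⟩ := taylorVec_reducedVec_isBigO hab hs hψ N ha hb hb0 j (by omega)
    have hP := rankOneProj_isBigO hab hs (h1 0 (by omega)) h3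
    have hT : ∀ p q, (fun τ => elemDarboux μ (iterVec μ (ψ τ) j) (ζ τ) p q
        - diagonal (fun r => if r = b then blaschke μ (ζ τ) ^ 1 else 1) p q) =O[l] s := by
      intro p q
      have h4 := (hκ.mul (hP p q)).neg_left
      simp only [one_mul] at h4
      refine h4.congr' ?_ EventuallyEq.rfl
      filter_upwards [hbl] with τ hτ
      rw [iterVec_eq hμ (hψ τ) j, elemDarboux_smul (inv_ne_zero (pow_ne_zero j (sub_ne_zero.mpr hμ))),
        elemDarboux_apply, hτ, taylorVec_zero]
      rcases hor p with rfl | rfl <;> rcases hor q with rfl | rfl <;> (simp [hab, hab.symm]; try ring)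
    have hB : ∀ p q, (fun τ => darbouxBlock μ (ψ τ) j (ζ τ) p q) =O[l] fun _ => (1 : ℝ) := fun p q =>
      (((ih' p q).trans hs1).add (hL j p q)).congr_left fun τ => by rw [Matrix.sub_apply]; ring
    -- Telescoping: AB - A₀B₀ = (A - A₀)B + A₀(B - B₀), so errors add without compounding powers of
    -- s.
    have hsplit : ∀ τ, darbouxBlock μ (ψ τ) (j + 1) (ζ τ)
          - diagonal (fun r => if r = b then blaschke μ (ζ τ) ^ (j + 1) else 1)
        = (elemDarboux μ (iterVec μ (ψ τ) j) (ζ τ) - diagonal (fun r => if r = b then blaschke μ (ζ τ) ^ 1 else 1))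
            * darbouxBlock μ (ψ τ) j (ζ τ)
          + diagonal (fun r => if r = b then blaschke μ (ζ τ) ^ 1 else 1) * (darbouxBlock μ (ψ τ) j (ζ τ)
            - diagonal (fun r => if r = b then blaschke μ (ζ τ) ^ j else 1)) := by
      intro τ
      have h5 : diagonal (fun r => if r = b then blaschke μ (ζ τ) ^ (j + 1) else 1)
          = diagonal (fun r => if r = b then blaschke μ (ζ τ) ^ 1 else 1)
            * diagonal (fun r => if r = b then blaschke μ (ζ τ) ^ j else 1) := by
        rw [diagonal_mul_diagonal]
        congr 1
        funext r
        split_ifs <;> ring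
      rw [h5, darbouxBlock_succ]
      noncomm_ring
    simp only [hsplit, Matrix.add_apply, Matrix.mul_apply]
    refine (Asymptotics.IsBigO.fun_sum fun r _ => ?_).add (Asymptotics.IsBigO.fun_sum fun r _ => ?_)
    · simpa using (hT p r).mul (hB r q)
    · simpa using (hL 1 p r).mul (ih' r q)

end Perturbation

/-! ### Asymptotics over the zero seed. -/

theorem differentiable_hirotaPhase (γ δ : ℝ) (μ : ℂ) {n : ℕ} (a : Fin n → ℂ) (x t : ℝ) :
    Differentiable ℂ (hirotaPhase γ δ μ a x t) := by
  unfold hirotaPhase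
  fun_prop

/-- Cauchy's estimate on |z - μ| = 1/|t|. On that circle the phase differs from its t-linear part at
μ by a bounded amount, so the radius costs only |t|^m. The real part of that t-linear part produces
the velocity. -/
theorem exists_taylorCoef_exp_hirotaPhase_le (γ δ : ℝ) (μ : ℂ) {n : ℕ} (a : Fin n → ℂ) (v R : ℝ) :
    ∃ C : ℝ, 0 ≤ C ∧ ∀ t ξ : ℝ, 1 ≤ |t| → |ξ| ≤ R → ∀ σ : ℝ, |σ| ≤ 1 → ∀ m : ℕ,
      ‖taylorCoef (fun z => Complex.exp (σ * (2 * hirotaPhase γ δ μ a (ξ + v * t) t z))) μ m‖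
        ≤ C * |t| ^ m * Real.exp (-2 * σ * t * μ.im * (v - solitonVelocity γ δ μ)) := by
  set A : ℂ → ℂ := fun z => ∑ j : Fin n, a j * (z - μ) ^ (j : ℕ) with hA
  -- The divided difference at μ of v z + 2γz² + 4δz³, the coefficient of i t in the phase.
  set W : ℂ → ℂ := fun z => v + 2 * γ * (z + μ) + 4 * δ * (z ^ 2 + z * μ + μ ^ 2) with hW
  set g : ℂ → ℝ := fun z => 2 * (R * ‖z‖ + ‖W z‖ + ‖A z‖ + Real.pi / 4) with hg
  have hgc : Continuous g := by
    simp only [hg, hA, hW]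
    fun_prop
  obtain ⟨K, hK⟩ := (isCompact_closedBall μ 1).bddAbove_image hgc.continuousOn
  refine ⟨Real.exp K, (Real.exp_pos K).le, fun t ξ ht hξ σ hσ m => ?_⟩
  have ht0 : 0 < |t| := lt_of_lt_of_le one_pos ht
  have hR : 0 ≤ R := (abs_nonneg ξ).trans hξ
  have hdiff : Differentiable ℂ fun z => Complex.exp (σ * (2 * hirotaPhase γ δ μ a (ξ + v * t) t z)) :=
    (((differentiable_hirotaPhase γ δ μ a (ξ + v * t) t).const_mul 2).const_mul _).cexp
  have hbound : ∀ z ∈ Metric.sphere μ |t|⁻¹,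
      ‖Complex.exp (σ * (2 * hirotaPhase γ δ μ a (ξ + v * t) t z))‖
        ≤ Real.exp K * Real.exp (-2 * σ * t * μ.im * (v - solitonVelocity γ δ μ)) := by
    intro z hz
    rw [mem_sphere_iff_norm] at hz
    rw [Complex.norm_exp, ← Real.exp_add, Real.exp_le_exp]
    have hsplit : (σ : ℂ) * (2 * hirotaPhase γ δ μ a (ξ + v * t) t z)
        = ((2 * σ * t : ℝ) : ℂ) * (Complex.I * (v * μ + 2 * γ * μ ^ 2 + 4 * δ * μ ^ 3))
          + (2 * σ : ℝ) * (Complex.I * ξ * z + t * Complex.I * (z - μ) * W z + A z - Complex.I / 4 * Real.pi) := by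
      simp only [hirotaPhase, hA, hW]
      push_cast
      ring
    have h1 : (((2 * σ * t : ℝ) : ℂ) * (Complex.I * (v * μ + 2 * γ * μ ^ 2 + 4 * δ * μ ^ 3))).re
        = -2 * σ * t * μ.im * (v - solitonVelocity γ δ μ) := by
      rw [Complex.re_ofReal_mul, solitonVelocity]
      simp [pow_succ]
      ring
    have h2 : ‖((2 * σ : ℝ) : ℂ) * (Complex.I * ξ * z + t * Complex.I * (z - μ) * W z + A z
        - Complex.I / 4 * Real.pi)‖ ≤ g z := by
      rw [norm_mul, Complex.norm_real, Real.norm_eq_abs, abs_mul, abs_two]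
      have e1 : ‖Complex.I * ξ * z‖ ≤ R * ‖z‖ := by
        rw [norm_mul, norm_mul, Complex.norm_I, one_mul, Complex.norm_real, Real.norm_eq_abs]
        gcongr
      have e2 : ‖t * Complex.I * (z - μ) * W z‖ = ‖W z‖ := by
        rw [norm_mul, norm_mul, norm_mul, Complex.norm_I, mul_one, Complex.norm_real, Real.norm_eq_abs, hz,
          mul_inv_cancel₀ ht0.ne', one_mul]
      have e3 : ‖Complex.I / 4 * Real.pi‖ = Real.pi / 4 := by
        rw [norm_mul, norm_div, Complex.norm_I, Complex.norm_real, Real.norm_eq_abs, abs_of_pos Real.pi_pos]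
        norm_num
        ring
      have e4 : ‖Complex.I * ξ * z + t * Complex.I * (z - μ) * W z + A z - Complex.I / 4 * Real.pi‖
          ≤ R * ‖z‖ + ‖W z‖ + ‖A z‖ + Real.pi / 4 := by
        refine (norm_sub_le _ _).trans ?_
        refine add_le_add ((norm_add_le _ _).trans (add_le_add ((norm_add_le _ _).trans
          (add_le_add e1 e2.le)) le_rfl)) e3.le
      calc _ ≤ 2 * 1 * (R * ‖z‖ + ‖W z‖ + ‖A z‖ + Real.pi / 4) := by gcongr
        _ = g z := by rw [hg]; ring
    have h3 : g z ≤ K := by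
      refine hK ⟨z, ?_, rfl⟩
      rw [mem_closedBall_iff_norm, hz]
      exact inv_le_one_of_one_le₀ ht
    rw [hsplit, Complex.add_re, h1]
    linarith [(Complex.re_le_norm _).trans h2]
  have h := Complex.norm_iteratedDeriv_le_of_forall_mem_sphere_norm_le m (inv_pos.mpr ht0) hdiff.diffContOnCl hbound
  rw [taylorCoef, norm_mul, norm_inv, Complex.norm_natCast, inv_mul_le_iff₀ (by positivity)]
  refine h.trans (le_of_eq ?_)
  rw [inv_pow, div_inv_eq_mul]
  ring

theorem darbouxBlock_hirotaVec_eq {μ : ℂ} (hμ : μ ≠ conj μ) (γ δ : ℝ) {n : ℕ} (a : Fin n → ℂ) (x t : ℝ) {b : Fin 2}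
    {σ : ℝ} (hbσ : (b = 1 ∧ σ = 1) ∨ (b = 0 ∧ σ = -1)) (m : ℕ) :
    darbouxBlock μ (hirotaVec γ δ μ a x t) m
      = darbouxBlock μ (fun z s => if s = b then 1 else Complex.exp (σ * (2 * hirotaPhase γ δ μ a x t z))) m := by
  have hd := differentiable_hirotaPhase γ δ μ a x t
  rcases hbσ with ⟨rfl, rfl⟩ | ⟨rfl, rfl⟩
  · congr 1
    funext z s
    fin_cases s <;> simp [hirotaVec]
  · have hψ : AnalyticAt ℂ (hirotaVec γ δ μ a x t) μ := by
      refine (Differentiable.analyticAt (differentiable_pi.mpr fun s => ?_) μ)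
      fin_cases s
      · exact (hd.const_mul 2).cexp
      · exact differentiable_const (1 : ℂ)
    have hc : Continuous fun z => Complex.exp (-(2 * hirotaPhase γ δ μ a x t z)) :=
      (hd.const_mul 2).neg.cexp.continuous
    rw [← darbouxBlock_smul hμ hψ (c := fun z => Complex.exp (-(2 * hirotaPhase γ δ μ a x t z))) hc.continuousAt
      (Complex.exp_ne_zero _)]
    congr 1
    funext z s
    fin_cases s
    · simp [hirotaVec, ← Complex.exp_add]
    · simp [hirotaVec]

theorem tendsto_pow_mul_exp_neg_mul_atTop {c : ℝ} (hc : 0 < c) (m : ℕ) :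
    Tendsto (fun u : ℝ => u ^ m * Real.exp (-(c * u))) atTop (𝓝 0) := by
  have h := ((Real.tendsto_pow_mul_exp_neg_atTop_nhds_zero m).comp (tendsto_id.const_mul_atTop hc)).const_mul ((c ^ m)⁻¹)
  rw [mul_zero] at h
  refine h.congr fun u => ?_
  have := (pow_pos hc m).ne'
  simp only [Function.comp_apply, id, mul_pow]
  field_simp

/-- Here κ is the sign of t, and σ selects the exponential exp(2σθ) that decays as κ t → ∞; b is the
component normalized to 1, which receives the Blaschke factor. -/
theorem exists_norm_darbouxBlock_hirotaVec_sub_le {μ : ℂ} (hμ : 0 < μ.im) (γ δ : ℝ) {n : ℕ}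
    (a : Fin n → ℂ) {v : ℝ} (hv : v ≠ solitonVelocity γ δ μ) (R : ℝ) {r : ℝ} (hr : 0 < r) {κ σ : ℝ}
    (hκ : κ = 1 ∨ κ = -1) {b : Fin 2} (hbσ : (b = 1 ∧ σ = 1) ∨ (b = 0 ∧ σ = -1))
    (hsign : σ * (v - solitonVelocity γ δ μ) = κ * |v - solitonVelocity γ δ μ|) :
    ∃ C t₀ : ℝ, 0 < t₀ ∧ ∀ t ξ : ℝ, ∀ z : ℂ, t₀ ≤ κ * t → |ξ| ≤ R → r ≤ ‖z - conj μ‖ → ∀ p q : Fin 2,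
      ‖(darbouxBlock μ (hirotaVec γ δ μ a (ξ + v * t) t) n z
          - diagonal (fun s => if s = b then blaschke μ z ^ n else 1)) p q‖
        ≤ C * (|t| ^ (n - 1) * Real.exp (-2 * μ.im * |v - solitonVelocity γ δ μ| * (κ * t))) := by
  set V := v - solitonVelocity γ δ μ with hV
  have hμ' : μ ≠ conj μ := fun h => by
    have := congrArg Complex.im h
    rw [Complex.conj_im] at this
    linarith
  have hσ1 : |σ| ≤ 1 := by rcases hbσ with ⟨-, rfl⟩ | ⟨-, rfl⟩ <;> norm_num
  have habs : ∀ t : ℝ, 0 ≤ κ * t → |t| = κ * t := fun t ht => by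
    rw [← abs_of_nonneg ht, abs_mul]
    rcases hκ with rfl | rfl <;> simp
  obtain ⟨a', hab⟩ : ∃ a' : Fin 2, a' ≠ b := exists_ne b
  -- Letting κ t → ∞ with ξ and z constrained only by their bounds makes every O along this filter
  -- uniform in ξ and z.
  set l : Filter (ℝ × ℝ × ℂ) := comap (fun τ => κ * τ.1) atTop ⊓ 𝓟 {τ | |τ.2.1| ≤ R ∧ r ≤ ‖τ.2.2 - conj μ‖} with hl
  set s : ℝ × ℝ × ℂ → ℝ := fun τ => |τ.1| ^ (n - 1) * Real.exp (-2 * μ.im * |V| * (κ * τ.1)) with hs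
  set ψ : ℝ × ℝ × ℂ → ℂ → Fin 2 → ℂ := fun τ z i =>
    if i = b then 1 else Complex.exp (σ * (2 * hirotaPhase γ δ μ a (τ.2.1 + v * τ.1) τ.1 z)) with hψdef
  have hlt : Tendsto (fun τ : ℝ × ℝ × ℂ => κ * τ.1) l atTop := tendsto_comap.mono_left inf_le_left
  have hlS : ∀ᶠ τ in l, |τ.2.1| ≤ R ∧ r ≤ ‖τ.2.2 - conj μ‖ := (mem_inf_of_right (mem_principal_self _))
  have hl1 : ∀ᶠ τ in l, 1 ≤ κ * τ.1 := hlt.eventually_ge_atTop 1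
  have hst : Tendsto s l (𝓝 0) := by
    have hc : 0 < 2 * μ.im * |V| := by
      have : 0 < |V| := abs_pos.mpr (sub_ne_zero.mpr hv)
      positivity
    refine ((tendsto_pow_mul_exp_neg_mul_atTop hc (n - 1)).comp hlt).congr' ?_
    filter_upwards [hl1] with τ hτ
    rw [Function.comp_apply, hs]
    simp only
    rw [habs τ.1 (by linarith)]
    congr 2
    ring
  have hψ : ∀ τ, AnalyticAt ℂ (ψ τ) μ := fun τ => by
    refine Differentiable.analyticAt (differentiable_pi.mpr fun i => ?_) μ
    by_cases hi : i = b
    · simp only [hψdef, hi, if_true]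
      exact differentiable_const _
    · simp only [hψdef, hi, if_false]
      exact (((differentiable_hirotaPhase γ δ μ a _ _).const_mul 2).const_mul _).cexp
  obtain ⟨C, hC0, hC⟩ := exists_taylorCoef_exp_hirotaPhase_le γ δ μ a v R
  have ha : ∀ m < n, (fun τ => taylorVec (ψ τ) μ m a') =O[l] s := by
    intro m hm
    refine Asymptotics.IsBigO.of_bound C ?_
    filter_upwards [hl1, hlS] with τ hτ1 hτS
    have hτ := habs τ.1 (by linarith)
    rw [taylorVec_apply (hψ τ)]
    simp only [hψdef, hab, if_false]
    refine (hC τ.1 τ.2.1 (by rw [hτ]; exact hτ1) hτS.1 σ hσ1 m).trans ?_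
    have h1 : -2 * σ * τ.1 * μ.im * V = -2 * μ.im * |V| * (κ * τ.1) := by
      linear_combination (-2 * τ.1 * μ.im) * hsign
    rw [Real.norm_eq_abs, abs_of_nonneg (show 0 ≤ s τ by simp only [hs]; positivity), h1, mul_assoc]
    simp only [hs]
    -- Only coefficients of index m ≤ n - 1 enter, whence the power n - 1 in the error.
    have h2 : |τ.1| ^ m ≤ |τ.1| ^ (n - 1) := pow_le_pow_right₀ (by rw [hτ]; exact hτ1) (by omega)
    gcongr
  have hbconst : ∀ τ m, taylorVec (ψ τ) μ m b = taylorCoef (fun _ => 1) μ m := fun τ m => by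
    rw [taylorVec_apply (hψ τ)]
    simp [hψdef]
  have hb : ∀ m < n, (fun τ => taylorVec (ψ τ) μ m b) =O[l] fun _ => (1 : ℝ) := fun m _ => by
    simp only [hbconst]
    exact Asymptotics.isBigO_const_const _ one_ne_zero _
  have hb0 : Tendsto (fun τ => taylorVec (ψ τ) μ 0 b) l (𝓝 1) := by
    simpa [taylorVec_zero, hψdef] using tendsto_const_nhds
  have hζ : ∀ᶠ τ in l, τ.2.2 ≠ conj μ := by
    filter_upwards [hlS] with τ hτ h
    rw [h, sub_self, norm_zero] at hτ
    linarith [hτ.2]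
  have hζ' : (fun τ : ℝ × ℝ × ℂ => (τ.2.2 - conj μ)⁻¹) =O[l] fun _ => (1 : ℝ) := by
    refine Asymptotics.IsBigO.of_bound r⁻¹ ?_
    filter_upwards [hlS] with τ hτ
    rw [norm_inv, norm_one, mul_one]
    exact inv_anti₀ hr hτ.2
  have key := fun p q => (darbouxBlock_sub_diagonal_isBigO hμ' hab hst hψ n ha hb hb0 hζ hζ' n le_rfl p q).bound
  choose D hD using key
  have hall : ∀ᶠ τ in l, ∀ p q : Fin 2, ‖(darbouxBlock μ (ψ τ) n τ.2.2
      - diagonal (fun s => if s = b then blaschke μ τ.2.2 ^ n else 1)) p q‖ ≤ D p q * ‖s τ‖ :=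
    eventually_all.mpr fun p => eventually_all.mpr fun q => hD p q
  rw [hl, eventually_inf_principal, eventually_comap] at hall
  obtain ⟨t₁, ht₁⟩ := eventually_atTop.mp hall
  -- Summing over the entries gives one constant for all of them; the maximum with 1 makes the
  -- threshold positive.
  refine ⟨∑ p, ∑ q, |D p q|, max t₁ 1, by positivity, fun t ξ z ht hξ hz p q => ?_⟩
  have h1 := ht₁ (κ * t) ((le_max_left _ _).trans ht) (t, ξ, z) rfl ⟨hξ, hz⟩ p q
  rw [darbouxBlock_hirotaVec_eq hμ' γ δ a _ t hbσ]
  have hsnn : 0 ≤ s (t, ξ, z) := by simp only [hs]; positivity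
  simp only [hψdef, Real.norm_eq_abs, abs_of_nonneg hsnn] at h1
  refine h1.trans (mul_le_mul_of_nonneg_right ?_ hsnn)
  calc D p q ≤ |D p q| := le_abs_self _
    _ ≤ ∑ q, |D p q| := Finset.single_le_sum (f := fun q => |D p q|) (fun _ _ => abs_nonneg _) (Finset.mem_univ q)
    _ ≤ ∑ p, ∑ q, |D p q| := Finset.single_le_sum (f := fun p => ∑ q, |D p q|)
        (fun _ _ => Finset.sum_nonneg fun _ _ => abs_nonneg _) (Finset.mem_univ p)

theorem fin_two_diagonal_eq (β : ℂ) :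
    (!![β, 0; 0, 1] : Matrix (Fin 2) (Fin 2) ℂ) = diagonal (fun s : Fin 2 => if s = 0 then β else 1) ∧
    (!![1, 0; 0, β] : Matrix (Fin 2) (Fin 2) ℂ) = diagonal (fun s : Fin 2 => if s = 1 then β else 1) := by
  constructor <;> ext i j <;> fin_cases i <;> fin_cases j <;> simp

/-- The parameters `λ₁, λ₂` are `lam 0, lam 1`, and likewise for `n`, `Φ` and `a`. -/
theorem lemma4p8 (lam : Fin 2 → ℂ) (n : Fin 2 → ℕ) (hn : ∀ i, 0 < n i)
    (hconj : ∀ i j, lam i ≠ conj (lam j)) (hne : lam 0 ≠ lam 1) :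
    -- the two factorizations, over any seed solution
    (∀ Φ : Fin 2 → ℝ → ℝ → ℂ → Fin 2 → ℂ,
      (∀ i x t, Differentiable ℂ (Φ i x t)) → (∀ i x t, Φ i x t (lam i) ≠ 0) →
      ∀ x t : ℝ,
        IsUnit (darbouxM lam n (fun i => Φ i x t)).det ∧
        IterationDefined (lam 1) (Φ 1 x t) (n 1) ∧
        IterationDefined (lam 0) (dressedVec lam n (fun i => Φ i x t) 0 1) (n 0) ∧
        IterationDefined (lam 0) (Φ 0 x t) (n 0) ∧
        IterationDefined (lam 1) (dressedVec lam n (fun i => Φ i x t) 1 0) (n 1) ∧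
        ∀ z : ℂ, z ≠ conj (lam 0) → z ≠ conj (lam 1) →
          darbouxT lam n (fun i => Φ i x t) z =
              outerBlock lam n (fun i => Φ i x t) 0 1 z * innerBlock lam n (fun i => Φ i x t) 1 z ∧
          darbouxT lam n (fun i => Φ i x t) z =
              outerBlock lam n (fun i => Φ i x t) 1 0 z * innerBlock lam n (fun i => Φ i x t) 0 z) ∧
    -- the asymptotics along `x = ξ + v t`, over the zero seed
    (∀ (γ δ : ℝ) (a : ∀ i, Fin (n i) → ℂ) (v : ℝ),
      (0 < (lam 1).im → v < solitonVelocity γ δ (lam 1) → ∀ R r : ℝ, 0 < R → 0 < r →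
        (∃ C t₀ : ℝ, 0 < t₀ ∧ ∀ t ξ : ℝ, ∀ z : ℂ, t₀ ≤ t → |ξ| ≤ R → r ≤ ‖z - conj (lam 1)‖ → ∀ p q : Fin 2,
          ‖(innerBlock lam n (fun i => hirotaVec γ δ (lam i) (a i) (ξ + v * t) t) 1 z
              - !![blaschke (lam 1) z ^ n 1, 0; 0, 1]) p q‖
            ≤ C * (|t| ^ (n 1 - 1)
                * Real.exp (-2 * (lam 1).im * |v - solitonVelocity γ δ (lam 1)| * t))) ∧
        (∃ C t₀ : ℝ, 0 < t₀ ∧ ∀ t ξ : ℝ, ∀ z : ℂ, t ≤ -t₀ → |ξ| ≤ R → r ≤ ‖z - conj (lam 1)‖ → ∀ p q : Fin 2,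
          ‖(innerBlock lam n (fun i => hirotaVec γ δ (lam i) (a i) (ξ + v * t) t) 1 z
              - !![1, 0; 0, blaschke (lam 1) z ^ n 1]) p q‖
            ≤ C * (|t| ^ (n 1 - 1)
                * Real.exp (2 * (lam 1).im * |v - solitonVelocity γ δ (lam 1)| * t)))) ∧
      (0 < (lam 0).im → solitonVelocity γ δ (lam 0) < v → ∀ R r : ℝ, 0 < R → 0 < r →
        (∃ C t₀ : ℝ, 0 < t₀ ∧ ∀ t ξ : ℝ, ∀ z : ℂ, t₀ ≤ t → |ξ| ≤ R → r ≤ ‖z - conj (lam 0)‖ → ∀ p q : Fin 2,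
          ‖(innerBlock lam n (fun i => hirotaVec γ δ (lam i) (a i) (ξ + v * t) t) 0 z
              - !![1, 0; 0, blaschke (lam 0) z ^ n 0]) p q‖
            ≤ C * (|t| ^ (n 0 - 1)
                * Real.exp (-2 * (lam 0).im * |v - solitonVelocity γ δ (lam 0)| * t))) ∧
        (∃ C t₀ : ℝ, 0 < t₀ ∧ ∀ t ξ : ℝ, ∀ z : ℂ, t ≤ -t₀ → |ξ| ≤ R → r ≤ ‖z - conj (lam 0)‖ → ∀ p q : Fin 2,
          ‖(innerBlock lam n (fun i => hirotaVec γ δ (lam i) (a i) (ξ + v * t) t) 0 z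
              - !![blaschke (lam 0) z ^ n 0, 0; 0, 1]) p q‖
            ≤ C * (|t| ^ (n 0 - 1)
                * Real.exp (2 * (lam 0).im * |v - solitonVelocity γ δ (lam 0)| * t))))) := by
  have hinj : Function.Injective lam := by
    intro i j h
    fin_cases i <;> fin_cases j <;> first | rfl | exact absurd h hne | exact absurd h.symm hne
  refine ⟨fun Φ hΦd hΦ0 x t => ?_, fun γ δ a v => ⟨fun him hv R r _ hr => ⟨?_, ?_⟩, fun him hv R r _ hr => ⟨?_, ?_⟩⟩⟩
  · have hΦ : ∀ j, AnalyticAt ℂ (Φ j x t) (lam j) := fun j => (hΦd j x t).analyticAt _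
    have hΦ0' : ∀ j, Φ j x t (lam j) ≠ 0 := fun j => hΦ0 j x t
    have h01 := isDressing_outerBlock_mul_innerBlock (n := n) hinj hconj hΦ hΦ0' (i := 0) (j := 1) (by decide)
    have h10 := isDressing_outerBlock_mul_innerBlock (n := n) hinj hconj hΦ hΦ0' (i := 1) (j := 0) (by decide)
    refine ⟨h01.isUnit_det_darbouxM hinj hconj hΦ hΦ0', iterationDefined (hconj 1 1) (hΦ 1) (hΦ0' 1) _,
      iterationDefined (hconj 0 0) (analyticAt_dressedVec hconj hΦ 0 1)
        (dressedVec_ne_zero hinj hconj hΦ hΦ0' (by decide)) _,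
      iterationDefined (hconj 0 0) (hΦ 0) (hΦ0' 0) _,
      iterationDefined (hconj 1 1) (analyticAt_dressedVec hconj hΦ 1 0)
        (dressedVec_ne_zero hinj hconj hΦ hΦ0' (by decide)) _, fun z hz0 hz1 => ?_⟩
    have hz : ∀ i, z ≠ conj (lam i) := Fin.forall_fin_two.mpr ⟨hz0, hz1⟩
    exact ⟨h01.darbouxT_eq hinj hconj hΦ hΦ0' hz, h10.darbouxT_eq hinj hconj hΦ hΦ0' hz⟩
  -- For v below the velocity and t → +∞, exp(2θ) grows, so the first component is the one
  -- normalized to 1. Reversing the sign of t or of v - v_i exchanges the components, which gives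
  -- the remaining cases.
  · obtain ⟨C, t₀, ht₀, h⟩ := exists_norm_darbouxBlock_hirotaVec_sub_le him γ δ (a 1) hv.ne R hr
      (κ := 1) (σ := -1) (Or.inl rfl) (b := 0) (Or.inr ⟨rfl, rfl⟩) (by rw [abs_of_neg (sub_neg.mpr hv)]; ring)
    refine ⟨C, t₀, ht₀, fun t ξ z ht hξ hz p q => ?_⟩
    have := h t ξ z (by linarith) hξ hz p q
    rwa [← (fin_two_diagonal_eq _).1, one_mul] at this
  · obtain ⟨C, t₀, ht₀, h⟩ := exists_norm_darbouxBlock_hirotaVec_sub_le him γ δ (a 1) hv.ne R hr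
      (κ := -1) (σ := 1) (Or.inr rfl) (b := 1) (Or.inl ⟨rfl, rfl⟩) (by rw [abs_of_neg (sub_neg.mpr hv)]; ring)
    refine ⟨C, t₀, ht₀, fun t ξ z ht hξ hz p q => ?_⟩
    have := h t ξ z (by linarith) hξ hz p q
    rwa [← (fin_two_diagonal_eq _).2, neg_one_mul, mul_neg, neg_mul, neg_mul, neg_mul, neg_neg] at this
  · obtain ⟨C, t₀, ht₀, h⟩ := exists_norm_darbouxBlock_hirotaVec_sub_le him γ δ (a 0) hv.ne' R hr
      (κ := 1) (σ := 1) (Or.inl rfl) (b := 1) (Or.inl ⟨rfl, rfl⟩) (by rw [abs_of_pos (sub_pos.mpr hv)])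
    refine ⟨C, t₀, ht₀, fun t ξ z ht hξ hz p q => ?_⟩
    have := h t ξ z (by linarith) hξ hz p q
    rwa [← (fin_two_diagonal_eq _).2, one_mul] at this
  · obtain ⟨C, t₀, ht₀, h⟩ := exists_norm_darbouxBlock_hirotaVec_sub_le him γ δ (a 0) hv.ne' R hr
      (κ := -1) (σ := -1) (Or.inr rfl) (b := 0) (Or.inr ⟨rfl, rfl⟩) (by rw [abs_of_pos (sub_pos.mpr hv)])
    refine ⟨C, t₀, ht₀, fun t ξ z ht hξ hz p q => ?_⟩
    have := h t ξ z (by linarith) hξ hz p q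
    rwa [← (fin_two_diagonal_eq _).1, neg_one_mul, mul_neg, neg_mul, neg_mul, neg_mul, neg_neg] at this
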